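/- **Terms.** Simple types are built from one base type $0$ by $\to$. Fix a tree signature: a set $\Sigma_0$ of constants of type $0$ and a set $\Sigma_2$ of constants of type $0\to0\to0$, and, for every type $\alpha$, constants $\omega^\alpha,\Omega^\alpha$ of type $\alpha$ and $Y$ of type $(\alpha\to\alpha)\to\alpha$. Terms are the simply typed $\lambda$-terms over these constants; $\to^*_{\beta\delta}$ is the reflexive-transitive closure of the contractions $(\lambda x.M)N\to M[N/x]$ and $YM\to M(YM)$, applied at any position. **Böhm trees.** If $M\to^*_{\beta\delta}\lambda\vec x.N_0N_1\dots N_k$ with $N_0$ a variable or a constant (and $k=0$ if $N_0=Y$), then $BT(M)$ is the possibly infinite ordered tree whose root is labelled $\lambda\vec x.N_0$ and has the subtrees $BT(N_1),\dots,BT(N_k)$; otherwise (that is, if $M$ is unsolvable) $BT(M)$ is a leaf $\Omega^\alpha$, where $\alpha$ is the type of $M$. For $n\ge 0$, $BT(M){\downarrow_n}$ is the finite term obtained from $BT(M)$ by replacing every subtree at depth $n$ by the constant $\omega$ of the appropriate type. **The model.** Let $\mathcal A$ be a tree automaton with trivial acceptance condition over this signature: a finite set $Q$ of states, an initial state $q^0\in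 Q$, and transition functions $\delta_0:Q\times(\Sigma_0\cup\{\Omega\})\to\{\mathit{ff},\mathit{tt}\}$ and $\delta_2:Q\times\Sigma_2\to\mathcal P(Q^2)$. Put $Q_\Omega=\{q:\delta_0(q,\Omega)=\mathit{tt}\}$. Let $\mathcal D_0=\{\bot<\top\}$ and let $\mathcal D_{\alpha\to\beta}$ be the lattice of monotone functions $\mathcal D_\alpha\to\mathcal D_\beta$. Define partially ordered sets $\mathcal K_\alpha$ and relations $\mathcal L_\alpha\subseteq\mathcal K_\alpha\times\mathcal D_\alpha$ by simultaneous recursion on $\alpha$: - $\mathcal K_0=\{(\top,P):P\subseteq Q\}\cup\{(\bot,Q_\Omega)\}$, ordered componentwise ($P$ by inclusion), and $\mathcal L_0=\{((d,P),d)\}$; - $\mathcal K_{\alpha\to\beta}$ is the set of the monotone $f:\mathcal K_\alpha\to\mathcal K_\beta$ for which some $d\in\mathcal D_{\alpha\to\beta}$ satisfies $(f(g),d(e))\in\mathcal L_\beta$ for all $(g,e)\in\mathcal L_\alpha$, ordered pointwise, and $\mathcal L_{\alpha\to\beta}$ is the set of all such pairs $(f,d)$. For every $f\in\mathcal K_\alpha$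 there is a unique $\bar f\in\mathcal D_\alpha$ with $(f,\bar f)\in\mathcal L_\alpha$, and for every $d\in\mathcal D_\alpha$ the set $\{p\in\mathcal K_\alpha:(p,d)\in\mathcal L_\alpha\}$ has a greatest element $d^\uparrow$. For $f\in\mathcal K_{\alpha\to\alpha}$ let $\mathrm{Fix}_\alpha(f)=\bigwedge_{n}f^n\big(\mathrm{fix}(\bar f)^\uparrow\big)$, where $\mathrm{fix}(\bar f)$ is the least fixpoint of $\bar f$. In the model $\mathcal K$ of $\mathcal A$ the constants are interpreted as follows: $Y$ of type $(\alpha\to\alpha)\to\alpha$ by $\mathrm{Fix}_\alpha$; $\omega^\alpha$ by the greatest element of $\mathcal K_\alpha$; $\Omega^0$ by $(\bot,Q_\Omega)$ and $\Omega^{\alpha\to\beta}$ by the constant function whose value is the interpretation of $\Omega^\beta$; $c\in\Sigma_0$ by $(\top,\{q:\delta_0(q,c)=\mathit{tt}\})$; and $a\in\Sigma_2$ by the function $(d_1,R_1)\mapsto(d_2,R_2)\mapsto(\top,\{q:\delta_2(q,a)\cap(R_1\times R_2)\neq\emptyset\})$. Variables, applications and abstractions are interpreted in the usual way. **Theorem.**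 For every closed term $M$ of type $0$, the set $\{[\![BT(M){\downarrow_n}]\!]_{\mathcal K}: n\in\mathbb N\}$ has a greatest lower bound in $\mathcal K_0$, and it equals the value of $M$: $$[\![M]\!]_{\mathcal K}=\bigwedge_{n\in\mathbb N}[\![BT(M){\downarrow_n}]\!]_{\mathcal K}.$$ -/

import Mathlib

/-! ## The simply typed `λY`-calculus over a tree signature -/

namespace LambdaY

universe u v w

/-- Simple types over the single base type `0`. -/
inductive Ty : Type
  | base : Ty
  | arr : Ty → Ty → Ty

infixr:60 " ⇒ " => Ty.arr

/-- A typing context: the list of the types of the free variables (de Bruijn style). -/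
abbrev Ctx : Type := List Ty

/-- `Var Γ α` is the set of the variables of type `α` in the context `Γ`. -/
inductive Var : Ctx → Ty → Type
  | zero {Γ : Ctx} {α : Ty} : Var (α :: Γ) α
  | succ {Γ : Ctx} {α β : Ty} : Var Γ α → Var (β :: Γ) α

/-- The constants other than the fixpoint combinators. `leaf c` (`c ∈ Σ₀`) has type `0`, `node a`
(`a ∈ Σ₂`) has type `0 → 0 → 0`; moreover there are two constants `ω` (`omegaCut`, used to
truncate Böhm trees) and `Ω` (`omegaDiv`, used for divergence) of every type. -/
inductive Cst (S₀ : Type u) (S₂ : Type v) : Ty → Type (max u v)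
  | leaf : S₀ → Cst S₀ S₂ .base
  | node : S₂ → Cst S₀ S₂ (.base ⇒ .base ⇒ .base)
  | omegaCut (α : Ty) : Cst S₀ S₂ α
  | omegaDiv (α : Ty) : Cst S₀ S₂ α

/-- Simply typed `λY`-terms of type `α` with free variables in the context `Γ`, up to renaming of
bound variables. `Tm S₀ S₂ [] α` is the set of the closed terms of type `α`. -/
inductive Tm (S₀ : Type u) (S₂ : Type v) : Ctx → Ty → Type (max u v)
  | var {Γ : Ctx} {α : Ty} : Var Γ α → Tm S₀ S₂ Γ α
  | cst {Γ : Ctx} {α : Ty} : Cst S₀ S₂ α → Tm S₀ S₂ Γ α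
  | fixY {Γ : Ctx} (α : Ty) : Tm S₀ S₂ Γ ((α ⇒ α) ⇒ α)
  | app {Γ : Ctx} {α β : Ty} : Tm S₀ S₂ Γ (α ⇒ β) → Tm S₀ S₂ Γ α → Tm S₀ S₂ Γ β
  | lam {Γ : Ctx} {α β : Ty} : Tm S₀ S₂ (α :: Γ) β → Tm S₀ S₂ Γ (α ⇒ β)

section TermDefs

variable {S₀ : Type u} {S₂ : Type v}

/-- Renamings of variables. -/
abbrev Ren (Γ Δ : Ctx) : Type := ∀ α : Ty, Var Γ α → Var Δ α

/-- The extension of a renaming under a binder. -/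
def Ren.lift {Γ Δ : Ctx} (r : Ren Γ Δ) {β : Ty} : Ren (β :: Γ) (β :: Δ)
  | _, .zero => .zero
  | _, .succ x => .succ (r _ x)

/-- The action of a renaming on terms. -/
def Tm.rename : {Γ Δ : Ctx} → {α : Ty} → Ren Γ Δ → Tm S₀ S₂ Γ α → Tm S₀ S₂ Δ α
  | _, _, _, r, .var x => .var (r _ x)
  | _, _, _, _, .cst c => .cst c
  | _, _, _, _, .fixY α => .fixY α
  | _, _, _, r, .app M N => .app (M.rename r) (N.rename r)
  | _, _, _, r, .lam M => .lam (M.rename r.lift)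

/-- Simultaneous substitutions. -/
abbrev Subst (S₀ : Type u) (S₂ : Type v) (Γ Δ : Ctx) : Type (max u v) :=
  ∀ α : Ty, Var Γ α → Tm S₀ S₂ Δ α

/-- The extension of a substitution under a binder. -/
def Subst.lift {Γ Δ : Ctx} (s : Subst S₀ S₂ Γ Δ) {β : Ty} : Subst S₀ S₂ (β :: Γ) (β :: Δ)
  | _, .zero => .var .zero
  | _, .succ x => (s _ x).rename fun _ => .succ

/-- The action of a (capture avoiding) substitution on terms. -/
def Tm.subst : {Γ Δ : Ctx} → {α : Ty} → Subst S₀ S₂ Γ Δ → Tm S₀ S₂ Γ α → Tm S₀ S₂ Δ α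
  | _, _, _, s, .var x => s _ x
  | _, _, _, _, .cst c => .cst c
  | _, _, _, _, .fixY α => .fixY α
  | _, _, _, s, .app M N => .app (M.subst s) (N.subst s)
  | _, _, _, s, .lam M => .lam (M.subst s.lift)

/-- The substitution of `N` for the last variable of the context. -/
def Subst.single {Γ : Ctx} {β : Ty} (N : Tm S₀ S₂ Γ β) : Subst S₀ S₂ (β :: Γ) Γ
  | _, .zero => N
  | _, .succ x => .var x

/-- One step of `βδ`-contraction, at any position of a term:
`(λx.M) N → M[N/x]` and `Y M → M (Y M)`. -/
inductive Step : {Γ : Ctx} → {α : Ty} → Tm S₀ S₂ Γ α → Tm S₀ S₂ Γ α → Prop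
  | beta {Γ : Ctx} {α β : Ty} (M : Tm S₀ S₂ (α :: Γ) β) (N : Tm S₀ S₂ Γ α) :
      Step (.app (.lam M) N) (M.subst (Subst.single N))
  | delta {Γ : Ctx} {α : Ty} (M : Tm S₀ S₂ Γ (α ⇒ α)) :
      Step (.app (.fixY α) M) (.app M (.app (.fixY α) M))
  | appL {Γ : Ctx} {α β : Ty} {M M' : Tm S₀ S₂ Γ (α ⇒ β)} (N : Tm S₀ S₂ Γ α) :
      Step M M' → Step (.app M N) (.app M' N)
  | appR {Γ : Ctx} {α β : Ty} (M : Tm S₀ S₂ Γ (α ⇒ β)) {N N' : Tm S₀ S₂ Γ α} :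
      Step N N' → Step (.app M N) (.app M N')
  | lam {Γ : Ctx} {α β : Ty} {M M' : Tm S₀ S₂ (α :: Γ) β} :
      Step M M' → Step (.lam M) (.lam M')

/-- `βδ`-reduction: the reflexive and transitive closure of `βδ`-contraction. -/
def Reduces {Γ : Ctx} {α : Ty} (M N : Tm S₀ S₂ Γ α) : Prop :=
  Relation.ReflTransGen Step M N

end TermDefs

/-! ## Head normal forms and Böhm trees -/

/-- `N₀ X₁ … Xₖ`: a head `N₀`, a variable or a constant other than `Y`, with a list of arguments
of the appropriate types taken in a family `X`. -/
inductive Spine (S₀ : Type u) (S₂ : Type v) (X : Ctx → Ty → Type w) :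
    Ctx → Ty → Type (max u v w)
  | var {Γ : Ctx} {α : Ty} : Var Γ α → Spine S₀ S₂ X Γ α
  | cst {Γ : Ctx} {α : Ty} : Cst S₀ S₂ α → Spine S₀ S₂ X Γ α
  | app {Γ : Ctx} {α β : Ty} : Spine S₀ S₂ X Γ (α ⇒ β) → X Γ α → Spine S₀ S₂ X Γ β

/-- `λx₁ … xₘ. N₀ X₁ … Xₖ` with `N₀` a variable or a constant, and with arguments in a family
`X`; the constant `Y` is allowed as `N₀` only if `k = 0`, as `Y X₁` is a redex.
With terms as arguments, these are the head normal forms; they are also the shapes of the nodes of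
a Böhm tree, with label `λx₁ … xₘ. N₀` and ordered list of subtrees `X₁ … Xₖ`. -/
inductive Hnf (S₀ : Type u) (S₂ : Type v) (X : Ctx → Ty → Type w) :
    Ctx → Ty → Type (max u v w)
  | spine {Γ : Ctx} {α : Ty} : Spine S₀ S₂ X Γ α → Hnf S₀ S₂ X Γ α
  | fixY {Γ : Ctx} (α : Ty) : Hnf S₀ S₂ X Γ ((α ⇒ α) ⇒ α)
  | lam {Γ : Ctx} {α β : Ty} : Hnf S₀ S₂ X (α :: Γ) β → Hnf S₀ S₂ X Γ (α ⇒ β)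

section TreeDefs

variable {S₀ : Type u} {S₂ : Type v}

/-- Apply a function to the arguments of a spine. -/
def Spine.map {X : Ctx → Ty → Type*} {X' : Ctx → Ty → Type*} (f : ∀ Γ α, X Γ α → X' Γ α)
    {Γ : Ctx} : {α : Ty} → Spine S₀ S₂ X Γ α → Spine S₀ S₂ X' Γ α
  | _, .var x => .var x
  | _, .cst c => .cst c
  | _, .app s a => .app (s.map f) (f _ _ a)

/-- Apply a function to the arguments of a head normal form. -/
def Hnf.map {X : Ctx → Ty → Type*} {X' : Ctx → Ty → Type*} (f : ∀ Γ α, X Γ α → X' Γ α) :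
    {Γ : Ctx} → {α : Ty} → Hnf S₀ S₂ X Γ α → Hnf S₀ S₂ X' Γ α
  | _, _, .spine s => .spine (s.map f)
  | _, _, .fixY α => .fixY α
  | _, _, .lam h => .lam (h.map f)

theorem Spine.map_map {X : Ctx → Ty → Type*} {X' : Ctx → Ty → Type*} {X'' : Ctx → Ty → Type*}
    (f : ∀ Γ α, X Γ α → X' Γ α) (g : ∀ Γ α, X' Γ α → X'' Γ α) {Γ : Ctx} {α : Ty}
    (s : Spine S₀ S₂ X Γ α) : (s.map f).map g = s.map fun Γ α x => g Γ α (f Γ α x) := by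
  induction s with
  | var x => rfl
  | cst c => rfl
  | app s a ih => simp only [Spine.map, ih]

theorem Hnf.map_map {X : Ctx → Ty → Type*} {X' : Ctx → Ty → Type*} {X'' : Ctx → Ty → Type*}
    (f : ∀ Γ α, X Γ α → X' Γ α) (g : ∀ Γ α, X' Γ α → X'' Γ α) {Γ : Ctx} {α : Ty}
    (h : Hnf S₀ S₂ X Γ α) : (h.map f).map g = h.map fun Γ α x => g Γ α (f Γ α x) := by
  induction h with
  | spine s => simp only [Hnf.map, Spine.map_map]
  | fixY α => rfl
  | lam h ih => simp only [Hnf.map, ih]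

/-- The term written by a spine whose arguments are terms. -/
def Spine.toTm {Γ : Ctx} : {α : Ty} → Spine S₀ S₂ (Tm S₀ S₂) Γ α → Tm S₀ S₂ Γ α
  | _, .var x => .var x
  | _, .cst c => .cst c
  | _, .app s N => .app s.toTm N

/-- The term written by a head normal form. -/
def Hnf.toTm : {Γ : Ctx} → {α : Ty} → Hnf S₀ S₂ (Tm S₀ S₂) Γ α → Tm S₀ S₂ Γ α
  | _, _, .spine s => s.toTm
  | _, _, .fixY α => .fixY α
  | _, _, .lam h => .lam h.toTm

/-- A term is solvable if it `βδ`-reduces to a head normal form. -/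
def Solvable {Γ : Ctx} {α : Ty} (M : Tm S₀ S₂ Γ α) : Prop :=
  ∃ h : Hnf S₀ S₂ (Tm S₀ S₂) Γ α, Reduces M h.toTm

variable (S₀ S₂) in
/-- The top parts, of depth less than `n`, of the infinitary trees built from the nodes `Hnf`:
`Prefix 0` has a single element, which carries no information, and an element of `Prefix (n + 1)`
is a root node together with the parts of depth less than `n` of its subtrees. -/
def Prefix : ℕ → Ctx → Ty → Type (max u v)
  | 0 => fun _ _ => PUnit
  | n + 1 => Hnf S₀ S₂ (Prefix n)

/-- Forget the nodes of depth `n` in a prefix of depth `n + 1`. -/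
def Prefix.cut : (n : ℕ) → (Γ : Ctx) → (α : Ty) → Prefix S₀ S₂ (n + 1) Γ α → Prefix S₀ S₂ n Γ α
  | 0 => fun _ _ _ => PUnit.unit
  | n + 1 => fun _ _ t => Hnf.map (X := Prefix S₀ S₂ (n + 1)) (X' := Prefix S₀ S₂ n)
      (Prefix.cut n) t

/-- A prefix of depth `n` as a term, with the constant `ω` of the appropriate type in place of
every subtree at depth `n`. -/
def Prefix.toTm : (n : ℕ) → (Γ : Ctx) → (α : Ty) → Prefix S₀ S₂ n Γ α → Tm S₀ S₂ Γ α
  | 0 => fun _ α _ => .cst (.omegaCut α)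
  | n + 1 => fun _ _ t => (Hnf.map (X := Prefix S₀ S₂ n) (X' := Tm S₀ S₂)
      (Prefix.toTm n) t).toTm

variable (S₀ S₂) in
/-- Ordered, potentially infinite typed trees with nodes labelled by `λx₁ … xₘ. N₀`, `N₀` a
variable or a constant: such a tree is given by its top parts of depth less than `n`, for all `n`,
each one being a part of the next one. -/
structure BoehmTree (Γ : Ctx) (α : Ty) : Type (max u v) where
  /-- the part of depth less than `n` -/
  pre : ∀ n : ℕ, Prefix S₀ S₂ n Γ α
  cut_pre : ∀ n : ℕ, Prefix.cut n Γ α (pre (n + 1)) = pre n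

/-- The finite term `t↓ₙ`: every subtree of `t` at depth `n` is replaced by `ω`. -/
def BoehmTree.truncate {Γ : Ctx} {α : Ty} (t : BoehmTree S₀ S₂ Γ α) (n : ℕ) : Tm S₀ S₂ Γ α :=
  Prefix.toTm n Γ α (t.pre n)

open Classical in
/-- The root of the Böhm tree of `M`: if `M` reduces to `λx₁ … xₘ. N₀ N₁ … Nₖ` with `N₀` a
variable or a constant, then it has the label `λx₁ … xₘ. N₀` and the subtrees below it are those
of `N₁`, …, `Nₖ`; otherwise it is a leaf labelled by `Ω`. (By confluence, all choices of the head
normal form give the same Böhm tree.) -/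
noncomputable def boehmRoot {Γ : Ctx} {α : Ty} (M : Tm S₀ S₂ Γ α) : Hnf S₀ S₂ (Tm S₀ S₂) Γ α :=
  if h : Solvable M then h.choose else .spine (.cst (.omegaDiv α))

/-- The part of depth less than `n` of the Böhm tree of a term. -/
noncomputable def boehmPrefix :
    (n : ℕ) → (Γ : Ctx) → (α : Ty) → Tm S₀ S₂ Γ α → Prefix S₀ S₂ n Γ α
  | 0 => fun _ _ _ => PUnit.unit
  | n + 1 => fun _ _ M => Hnf.map (X := Tm S₀ S₂) (X' := Prefix S₀ S₂ n)
      (boehmPrefix n) (boehmRoot M)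

theorem cut_boehmPrefix (n : ℕ) (Γ : Ctx) (α : Ty) (M : Tm S₀ S₂ Γ α) :
    Prefix.cut n Γ α (boehmPrefix (n + 1) Γ α M) = boehmPrefix n Γ α M := by
  induction n generalizing Γ α M with
  | zero => rfl
  | succ n ih =>
    have h := Hnf.map_map (boehmPrefix (n + 1)) (Prefix.cut n) (boehmRoot M)
    have h2 : (fun Γ α (M : Tm S₀ S₂ Γ α) => Prefix.cut n Γ α (boehmPrefix (n + 1) Γ α M))
        = boehmPrefix n := by
      funext Γ α M
      exact ih Γ α M
    rw [h2] at h
    exact h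

/-- The Böhm tree `BT(M)` of a term `M`. -/
noncomputable def boehmTree {Γ : Ctx} {α : Ty} (M : Tm S₀ S₂ Γ α) : BoehmTree S₀ S₂ Γ α where
  pre n := boehmPrefix n Γ α M
  cut_pre n := cut_boehmPrefix n Γ α M

end TreeDefs

/-! ## The applicative structures `𝒟` and `𝒦`, and the logical relation `ℒ` between them -/

/-- The sets `𝒦_α` and `𝒟_α` at one type `α`, with their orders, and the relation
`ℒ_α ⊆ 𝒦_α × 𝒟_α`. -/
structure Level : Type (u + 1) where
  K : Type u
  D : Type
  [orderK : PartialOrder K]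
  [latticeD : CompleteLattice D]
  L : K → D → Prop

attribute [instance] Level.orderK Level.latticeD

/-- The simultaneous recursive definition of `𝒦_α`, `𝒟_α` and `ℒ_α`. Here `⊥` and `⊤` of `𝒟₀` are
`false` and `true`, `W` is the set `Q_Ω`, and subsets of `Q` are ordered by inclusion. -/
noncomputable def level {Q : Type u} (W : Set Q) : Ty → Level.{u}
  | .base =>
    { K := {p : Bool × Set Q // p.1 = true ∨ p = (false, W)}
      D := Bool
      L := fun p d => p.1.1 = d }
  | .arr α β =>
    { K := {f : (level W α).K →o (level W β).K // ∃ d : (level W α).D →o (level W β).D,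
        ∀ g e, (level W α).L g e → (level W β).L (f g) (d e)}
      D := (level W α).D →o (level W β).D
      L := fun f d => ∀ g e, (level W α).L g e → (level W β).L (f.1 g) (d e) }

section Model

variable {Q : Type u} (W : Set Q)

/-- The set `𝒦_α`. -/
abbrev KK (α : Ty) : Type u := (level W α).K

/-- The lattice `𝒟_α`. -/
abbrev DD (α : Ty) : Type := (level W α).D

/-- The relation `ℒ_α`. -/
abbrev LL (α : Ty) : KK W α → DD W α → Prop := (level W α).L

variable {W}

/-- The monotone function which underlies an element of `𝒦_{α → β}`. -/
def KK.fn {α β : Ty} (f : KK W (α ⇒ β)) : KK W α →o KK W β := f.1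

/-- The monotone function which is an element of `𝒟_{α → β}`. -/
def DD.fn {α β : Ty} (d : DD W (α ⇒ β)) : DD W α →o DD W β := d

/-- The element of `𝒦_{α → β}` given by a monotone function. -/
def KK.mk {α β : Ty} (f : KK W α →o KK W β)
    (h : ∃ d : DD W α →o DD W β, ∀ g e, LL W α g e → LL W β (f g) (d e)) : KK W (α ⇒ β) :=
  ⟨f, h⟩

theorem KK.le_iff {α β : Ty} {f g : KK W (α ⇒ β)} : f ≤ g ↔ ∀ p, f.fn p ≤ g.fn p := Iff.rfl

theorem LL_arr {α β : Ty} {f : KK W (α ⇒ β)} {d : DD W (α ⇒ β)} :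
    LL W (α ⇒ β) f d ↔ ∀ g e, LL W α g e → LL W β (f.fn g) (DD.fn d e) := Iff.rfl

theorem exists_galois (W : Set Q) (α : Ty) :
    ∃ (b : KK W α → DD W α) (t : DD W α → KK W α), (∀ f d, LL W α f d ↔ b f = d) ∧
      (∀ d, b (t d) = d) ∧ ∀ f d, f ≤ t d ↔ b f ≤ d := by
  induction α with
  | base =>
    refine ⟨fun p => p.1.1, fun (d : Bool) => ⟨(d, if d = true then Set.univ else W), by cases d <;> simp⟩,
      fun f d => Iff.rfl, fun d => rfl, ?_⟩
    rintro ⟨⟨c, P⟩, hp⟩ (d : Bool)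
    change ((c, P) : Bool × Set Q) ≤ (d, if d = true then Set.univ else W) ↔ c ≤ d
    rw [Prod.mk_le_mk]
    cases d <;> cases c <;> simp_all
  | arr α β iha ihb =>
    obtain ⟨ba, ta, ha1, ha2, ha3⟩ := iha
    obtain ⟨bb, tb, hb1, hb2, hb3⟩ := ihb
    have mba : Monotone ba := fun f g h => (ha3 _ _).1 (h.trans ((ha3 _ _).2 le_rfl))
    have mbb : Monotone bb := fun f g h => (hb3 _ _).1 (h.trans ((hb3 _ _).2 le_rfl))
    have mta : Monotone ta := fun d e h => (ha3 _ _).2 ((ha2 d).le.trans h)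
    have mtb : Monotone tb := fun d e h => (hb3 _ _).2 ((hb2 d).le.trans h)
    let b : KK W (α ⇒ β) → (DD W α →o DD W β) := fun f =>
      ⟨fun e => bb (f.fn (ta e)), fun e e' h => mbb (f.fn.monotone (mta h))⟩
    let t : DD W (α ⇒ β) → KK W (α ⇒ β) := fun d =>
      KK.mk ⟨fun g => tb (DD.fn d (ba g)), fun g g' h => mtb ((DD.fn d).monotone (mba h))⟩
        ⟨d, fun g e h => (hb1 _ _).2 (by
          rw [← (ha1 _ _).1 h]; exact hb2 _)⟩
    have key : ∀ f d, LL W (α ⇒ β) f d → b f = d := by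
      intro f d h
      refine OrderHom.ext _ _ (funext fun e => ?_)
      exact (hb1 _ _).1 (h (ta e) e ((ha1 _ _).2 (ha2 e)))
    have h1 : ∀ f d, LL W (α ⇒ β) f d ↔ b f = d := by
      intro f d
      refine ⟨key f d, ?_⟩
      rintro rfl
      obtain ⟨d', hd'⟩ := f.2
      have h' : LL W (α ⇒ β) f d' := hd'
      have := key f d' h'
      rw [this]
      exact h'
    refine ⟨b, t, h1, ?_, ?_⟩
    · intro d
      refine OrderHom.ext _ _ (funext fun e => ?_)
      change bb (tb (DD.fn d (ba (ta e)))) = _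
      rw [hb2, ha2]
      rfl
    · intro f d
      constructor
      · intro h e
        have h2 : f.fn (ta e) ≤ tb (DD.fn d (ba (ta e))) := h (ta e)
        rw [hb3, ha2] at h2
        exact h2
      · intro h g
        change f.fn g ≤ tb (DD.fn d (ba g))
        rw [hb3]
        have h2 : LL W (α ⇒ β) f (b f) := (h1 _ _).2 rfl
        have h3 : bb (f.fn g) = DD.fn (b f) (ba g) := (hb1 _ _).1 (h2 g (ba g) ((ha1 _ _).2 rfl))
        rw [h3]
        exact h (ba g)

theorem existsUnique_LL {α : Ty} (f : KK W α) : ∃! d : DD W α, LL W α f d := by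
  obtain ⟨b, t, h1, -, -⟩ := exists_galois W α
  exact ⟨b f, (h1 _ _).2 rfl, fun d h => ((h1 _ _).1 h).symm⟩

theorem exists_greatest_LL {α : Ty} (d : DD W α) : ∃ p : KK W α, IsGreatest {f | LL W α f d} p := by
  obtain ⟨b, t, h1, h2, h3⟩ := exists_galois W α
  exact ⟨t d, (h1 _ _).2 (h2 d), fun f hf => (h3 _ _).2 ((h1 _ _).1 hf).le⟩

/-- The projection of `f ∈ 𝒦_α`: the unique `d ∈ 𝒟_α` with `(f, d) ∈ ℒ_α`. -/
noncomputable def bar {α : Ty} (f : KK W α) : DD W α := (existsUnique_LL f).choose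

/-- The embedding of `𝒟_α` into `𝒦_α`: `d↑` is the greatest element (hence the join) of the set
`L_d = {p ∈ 𝒦_α | (p, d) ∈ ℒ_α}`. -/
noncomputable def up {α : Ty} (d : DD W α) : KK W α := (exists_greatest_LL d).choose

theorem LL_bar {α : Ty} (f : KK W α) : LL W α f (bar f) := (existsUnique_LL f).choose_spec.1

theorem bar_eq {α : Ty} {f : KK W α} {d : DD W α} (h : LL W α f d) : bar f = d :=
  ((existsUnique_LL f).choose_spec.2 d h).symm

theorem up_spec {α : Ty} (d : DD W α) : IsGreatest {f | LL W α f d} (up d) :=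
  (exists_greatest_LL d).choose_spec

theorem le_up_iff {α : Ty} {f : KK W α} {d : DD W α} : f ≤ up d ↔ bar f ≤ d := by
  obtain ⟨b, t, h1, h2, h3⟩ := exists_galois W α
  have hb : bar f = b f := bar_eq ((h1 _ _).2 rfl)
  have hu : up d = t d := (up_spec d).unique
    ⟨(h1 _ _).2 (h2 d), fun f hf => (h3 _ _).2 ((h1 _ _).1 hf).le⟩
  rw [hb, hu, h3]

theorem LL_up {α : Ty} (d : DD W α) : LL W α (up d) d := (up_spec d).1

theorem bar_mono {α : Ty} : Monotone (bar : KK W α → DD W α) := fun _ _ h =>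
  le_up_iff.1 (h.trans (le_up_iff.2 le_rfl))

theorem up_mono {α : Ty} : Monotone (up : DD W α → KK W α) := fun d _ h =>
  le_up_iff.2 ((bar_eq (LL_up d)).le.trans h)

/-- The greatest element of `𝒦_α`. -/
noncomputable instance KK.orderTop (α : Ty) : OrderTop (KK W α) where
  top := up ⊤
  le_top _ := le_up_iff.2 le_top

theorem LL_top (α : Ty) : LL W α ⊤ ⊤ := LL_up ⊤

variable (W) in
/-- The elements of `𝒦_α` that interpret divergence: `(⊥, Q_Ω)` at the type `0`, and the constant
functions at the other types. -/
noncomputable def bbot : (α : Ty) → KK W α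
  | .base => ⟨(false, W), Or.inr rfl⟩
  | .arr _ β => KK.mk ⟨fun _ => bbot β, fun _ _ _ => le_rfl⟩
      ⟨⟨fun _ => bar (bbot β), fun _ _ _ => le_rfl⟩, fun _ _ _ => LL_bar _⟩

/-! ### The fixpoint operator of `𝒦` -/

/-- The least fixpoint of an element of `𝒟_{α → α}`. -/
noncomputable def lfpD {α : Ty} (d : DD W (α ⇒ α)) : DD W α := OrderHom.lfp (DD.fn d)

/-- The iterates `fⁿ(fix(f̄)↑)`. -/
noncomputable def fixSeq {α : Ty} (f : KK W (α ⇒ α)) (n : ℕ) : KK W α :=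
  f.fn^[n] (up (lfpD (bar f)))

theorem LL_fixSeq {α : Ty} (f : KK W (α ⇒ α)) (n : ℕ) :
    LL W α (fixSeq f n) (lfpD (bar f)) := by
  induction n with
  | zero => exact LL_up _
  | succ n ih =>
    have h := LL_bar f _ _ ih
    have h2 : DD.fn (bar f) (lfpD (bar f)) = lfpD (bar f) := OrderHom.map_lfp _
    have h3 : fixSeq f (n + 1) = f.fn (fixSeq f n) := Function.iterate_succ_apply' _ _ _
    rw [h3]
    exact h2 ▸ h

theorem fixSeq_antitone {α : Ty} (f : KK W (α ⇒ α)) : Antitone (fixSeq f) := by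
  refine antitone_nat_of_succ_le fun n => ?_
  have h0 : f.fn (up (lfpD (bar f))) ≤ up (lfpD (bar f)) := (up_spec _).2 (LL_fixSeq f 1)
  unfold fixSeq
  rw [Function.iterate_succ_apply]
  exact f.fn.monotone.iterate n h0

theorem finite_KK [Finite Q] (α : Ty) : Finite (KK W α) := by
  induction α with
  | base => exact inferInstanceAs (Finite {p : Bool × Set Q // p.1 = true ∨ p = (false, W)})
  | arr α β iha ihb =>
    exact Finite.of_injective (β := KK W α → KK W β) (fun f : KK W (α ⇒ β) => ⇑f.fn)
      fun f g h => Subtype.ext (OrderHom.ext _ _ h)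

theorem exists_eq_fixSeq_isGLB [Finite Q] {α : Ty} (f : KK W (α ⇒ α)) :
    ∃ n, IsGLB (Set.range (fixSeq f)) (fixSeq f n) := by
  have := finite_KK (W := W) α
  obtain ⟨n, hn⟩ := WellFoundedLT.antitone_chain_condition (fixSeq_antitone f)
  refine ⟨n, ?_, fun g hg => hg ⟨n, rfl⟩⟩
  rintro _ ⟨m, rfl⟩
  rcases le_total n m with h | h
  · exact (hn m h).le
  · exact fixSeq_antitone f h

theorem exists_isGLB_fixSeq [Finite Q] {α : Ty} (f : KK W (α ⇒ α)) :
    ∃ p, IsGLB (Set.range (fixSeq f)) p :=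
  (exists_eq_fixSeq_isGLB f).imp' _ fun _ h => h

/-- `Fix_α(f) = ⋀ₙ fⁿ(fix(f̄)↑)`. -/
noncomputable def fixVal [Finite Q] {α : Ty} (f : KK W (α ⇒ α)) : KK W α :=
  (exists_isGLB_fixSeq f).choose

theorem isGLB_fixVal [Finite Q] {α : Ty} (f : KK W (α ⇒ α)) :
    IsGLB (Set.range (fixSeq f)) (fixVal f) := (exists_isGLB_fixSeq f).choose_spec

theorem fixVal_mono [Finite Q] {α : Ty} : Monotone (fixVal : KK W (α ⇒ α) → KK W α) := by
  intro f g h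
  refine (isGLB_fixVal g).2 ?_
  rintro _ ⟨n, rfl⟩
  refine ((isGLB_fixVal f).1 ⟨n, rfl⟩).trans ?_
  have h0 : up (lfpD (bar f)) ≤ up (lfpD (bar g)) := up_mono (OrderHom.lfp.monotone (bar_mono h))
  exact (f.fn.monotone.iterate n h0).trans (f.fn.monotone.iterate_le_of_le h n _)

theorem LL_fixVal [Finite Q] {α : Ty} (f : KK W (α ⇒ α)) : LL W α (fixVal f) (lfpD (bar f)) := by
  obtain ⟨n, hn⟩ := exists_eq_fixSeq_isGLB f
  rw [(isGLB_fixVal f).unique hn]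
  exact LL_fixSeq f n

variable (W) in
/-- The fixpoint operator, as an element of `𝒦_{(α → α) → α}`. -/
noncomputable def fixK [Finite Q] (α : Ty) : KK W ((α ⇒ α) ⇒ α) :=
  KK.mk ⟨fixVal, fixVal_mono⟩ ⟨OrderHom.lfp, fun f e h => by
    have h2 := LL_fixVal f
    rw [bar_eq h] at h2
    exact h2⟩

/-! ### The interpretation of terms in `𝒦` -/

variable (W) in
/-- Variable assignments with values in `𝒦`, ordered pointwise. -/
abbrev Env (Γ : Ctx) : Type u := ∀ α : Ty, Var Γ α → KK W α

variable (W) in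
/-- Variable assignments with values in `𝒟`, ordered pointwise. -/
abbrev EnvD (Γ : Ctx) : Type := ∀ α : Ty, Var Γ α → DD W α

/-- The assignment which extends `ρ` by the value `p` for the last variable. -/
def Env.cons {Γ : Ctx} {β : Ty} (p : KK W β) (ρ : Env W Γ) : Env W (β :: Γ)
  | _, .zero => p
  | _, .succ x => ρ _ x

/-- The same for assignments with values in `𝒟`. -/
def EnvD.cons {Γ : Ctx} {β : Ty} (d : DD W β) (δ : EnvD W Γ) : EnvD W (β :: Γ)
  | _, .zero => d
  | _, .succ x => δ _ x

theorem Env.cons_mono {Γ : Ctx} {β : Ty} {p p' : KK W β} {ρ ρ' : Env W Γ} (hp : p ≤ p')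
    (hr : ρ ≤ ρ') : Env.cons p ρ ≤ Env.cons p' ρ' := by
  intro α x
  cases x with
  | zero => exact hp
  | succ x => exact hr _ x

theorem EnvD.cons_mono {Γ : Ctx} {β : Ty} {p p' : DD W β} {ρ ρ' : EnvD W Γ} (hp : p ≤ p')
    (hr : ρ ≤ ρ') : EnvD.cons p ρ ≤ EnvD.cons p' ρ' := by
  intro α x
  cases x with
  | zero => exact hp
  | succ x => exact hr _ x

variable (W) in
/-- Functions from assignments to `𝒦_α` that are monotone and related to a monotone function from
assignments with values in `𝒟` to `𝒟_α`. -/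
def Den (Γ : Ctx) (α : Ty) : Type u :=
  {F : Env W Γ →o KK W α // ∃ G : EnvD W Γ →o DD W α,
    ∀ ρ δ, (∀ β x, LL W β (ρ β x) (δ β x)) → LL W α (F ρ) (G δ)}

/-- The interpretation of a variable. -/
def Den.var {Γ : Ctx} {α : Ty} (x : Var Γ α) : Den W Γ α :=
  ⟨⟨fun ρ => ρ α x, fun _ _ h => h α x⟩,
    ⟨⟨fun δ => δ α x, fun _ _ h => h α x⟩, fun _ _ h => h α x⟩⟩

/-- The interpretation of a constant whose value is `p`. -/
noncomputable def Den.const {Γ : Ctx} {α : Ty} (p : KK W α) : Den W Γ α :=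
  ⟨⟨fun _ => p, fun _ _ _ => le_rfl⟩,
    ⟨⟨fun _ => bar p, fun _ _ _ => le_rfl⟩, fun _ _ _ => LL_bar p⟩⟩

/-- The interpretation of an application. -/
noncomputable def Den.app {Γ : Ctx} {α β : Ty} (F : Den W Γ (α ⇒ β)) (F' : Den W Γ α) : Den W Γ β :=
  ⟨⟨fun ρ => (F.1 ρ).fn (F'.1 ρ), fun ρ ρ' h =>
      ((F.1 ρ).fn.monotone (F'.1.monotone h)).trans (F.1.monotone h (F'.1 ρ'))⟩, by
    obtain ⟨G, hG⟩ := F.2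
    obtain ⟨G', hG'⟩ := F'.2
    exact ⟨⟨fun δ => DD.fn (G δ) (G' δ), fun δ δ' h =>
      ((DD.fn (G δ)).monotone (G'.monotone h)).trans (G.monotone h (G' δ'))⟩,
      fun ρ δ h => hG ρ δ h _ _ (hG' ρ δ h)⟩⟩

theorem LL_cons {Γ : Ctx} {β : Ty} {p : KK W β} {d : DD W β} {ρ : Env W Γ} {δ : EnvD W Γ}
    (hp : LL W β p d) (hr : ∀ γ x, LL W γ (ρ γ x) (δ γ x)) (γ : Ty) (x : Var (β :: Γ) γ) :
    LL W γ (Env.cons p ρ γ x) (EnvD.cons d δ γ x) := by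
  cases x with
  | zero => exact hp
  | succ x => exact hr _ x

/-- The interpretation of an abstraction: `ρ ↦ (p ↦ F (ρ, p))`. -/
noncomputable def Den.lam {Γ : Ctx} {α β : Ty} (F : Den W (α :: Γ) β) : Den W Γ (α ⇒ β) :=
  ⟨⟨fun ρ => KK.mk ⟨fun p => F.1 (Env.cons p ρ),
        fun _ _ h => F.1.monotone (Env.cons_mono h le_rfl)⟩ (by
      obtain ⟨G, hG⟩ := F.2
      exact ⟨⟨fun d => G (EnvD.cons d fun γ x => bar (ρ γ x)),
          fun _ _ h => G.monotone (EnvD.cons_mono h le_rfl)⟩,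
        fun p d h => hG _ _ (LL_cons h fun γ x => LL_bar _)⟩),
      fun _ _ h p => F.1.monotone (Env.cons_mono le_rfl h)⟩, by
    obtain ⟨G, hG⟩ := F.2
    exact ⟨⟨fun δ => (⟨fun d => G (EnvD.cons d δ),
          fun _ _ h => G.monotone (EnvD.cons_mono h le_rfl)⟩ : DD W α →o DD W β),
        fun _ _ h d => G.monotone (EnvD.cons_mono le_rfl h)⟩,
      fun ρ δ h p d hp => hG _ _ (LL_cons hp h)⟩⟩

/-- The interpretation of terms in `𝒦`, given the values of the constants other than `Y`; the
constant `Y` is interpreted as the fixpoint operator `Fix`. -/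
noncomputable def interp [Finite Q] {S₀ : Type v} {S₂ : Type w} (c : ∀ α, Cst S₀ S₂ α → KK W α) :
    {Γ : Ctx} → {α : Ty} → Tm S₀ S₂ Γ α → Den W Γ α
  | _, _, .var x => Den.var x
  | _, _, .cst a => Den.const (c _ a)
  | _, _, .fixY α => Den.const (fixK W α)
  | _, _, .app M N => Den.app (interp c M) (interp c N)
  | _, _, .lam M => Den.lam (interp c M)

end Model

/-! ## Automata and their models -/

/-- A finite tree automaton with trivial acceptance conditions over the tree signature
`Σ = Σ₀ ∪ Σ₂` (when the set `Q` of states is finite). The letter `none : Option S₀` is `Ω`. -/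
structure TAC (Q : Type u) (S₀ : Type v) (S₂ : Type w) : Type (max u v w) where
  /-- the initial state `q⁰` -/
  init : Q
  /-- `δ₀ : Q × (Σ₀ ∪ {Ω}) → {ff, tt}` -/
  δ₀ : Q → Option S₀ → Bool
  /-- `δ₂ : Q × Σ₂ → 𝒫(Q²)` -/
  δ₂ : Q → S₂ → Set (Q × Q)

namespace TAC

variable {Q : Type u} {S₀ : Type v} {S₂ : Type w} (A : TAC Q S₀ S₂)

/-- The set `Q_Ω` of the states from which the automaton accepts `Ω`. -/
def QΩ : Set Q := {q | A.δ₀ q none = true}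

/-- The value `(⊤, {q | δ₀(q, c) = tt})` of a constant `c` of type `0`. -/
def leafVal (c : S₀) : KK A.QΩ .base := ⟨(true, {q | A.δ₀ q (some c) = true}), Or.inl rfl⟩

/-- The value `(⊤, {q | δ₂(q, a) ∩ R₁ × R₂ ≠ ∅})` of a constant `a` of type `0 → 0 → 0` at the
arguments `(d₁, R₁)` and `(d₂, R₂)`. -/
def nodeFun (a : S₂) (p₁ p₂ : KK A.QΩ .base) : KK A.QΩ .base :=
  ⟨(true, {q | (A.δ₂ q a ∩ p₁.1.2 ×ˢ p₂.1.2).Nonempty}), Or.inl rfl⟩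

theorem nodeFun_mono (a : S₂) {p₁ p₁' p₂ p₂' : KK A.QΩ .base} (h₁ : p₁ ≤ p₁') (h₂ : p₂ ≤ p₂') :
    A.nodeFun a p₁ p₂ ≤ A.nodeFun a p₁' p₂' := by
  refine ⟨le_rfl, fun q hq => ?_⟩
  exact Set.Nonempty.mono (Set.inter_subset_inter_right _ (Set.prod_mono h₁.2 h₂.2)) hq

/-- The value of a constant of type `0 → 0 → 0`. -/
def nodeVal (a : S₂) : KK A.QΩ (.base ⇒ .base ⇒ .base) :=
  KK.mk ⟨fun p₁ => KK.mk ⟨fun p₂ => A.nodeFun a p₁ p₂, fun _ _ h => A.nodeFun_mono a le_rfl h⟩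
      ⟨⟨fun _ => true, fun _ _ _ => le_rfl⟩, fun _ _ _ => rfl⟩,
    fun _ _ h _ => A.nodeFun_mono a h le_rfl⟩
    ⟨⟨fun _ => (⟨fun _ => true, fun _ _ _ => le_rfl⟩ : Bool →o Bool), fun _ _ _ => le_rfl⟩,
      fun _ _ _ _ _ _ => rfl⟩

/-- The valuation of the constants: `ω` is the greatest element, and `Ω` is `bbot`. -/
noncomputable def val : ∀ α, Cst S₀ S₂ α → KK A.QΩ α
  | _, .leaf c => A.leafVal c
  | _, .node a => A.nodeVal a
  | _, .omegaCut _ => ⊤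
  | _, .omegaDiv α => bbot A.QΩ α

/-- The value in the model `𝒦` of the automaton of a term under a variable assignment. -/
noncomputable def evalEnv [Finite Q] {Γ : Ctx} {α : Ty} (M : Tm S₀ S₂ Γ α) (ρ : Env A.QΩ Γ) :
    KK A.QΩ α :=
  (interp A.val M).1 ρ

/-- The value of a closed term in the model `𝒦` of the automaton. -/
noncomputable def eval [Finite Q] {α : Ty} (M : Tm S₀ S₂ [] α) : KK A.QΩ α :=
  A.evalEnv M fun _ x => nomatch x

section Clauses

variable [Finite Q] {Γ : Ctx} {α β : Ty} (ρ : Env A.QΩ Γ)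

theorem evalEnv_var (x : Var Γ α) : A.evalEnv (.var x) ρ = ρ α x := rfl

theorem evalEnv_cst (c : Cst S₀ S₂ α) : A.evalEnv (.cst c) ρ = A.val α c := rfl

theorem evalEnv_fixY : A.evalEnv (.fixY α) ρ = fixK A.QΩ α := rfl

theorem evalEnv_app (M : Tm S₀ S₂ Γ (α ⇒ β)) (N : Tm S₀ S₂ Γ α) :
    A.evalEnv (.app M N) ρ = (A.evalEnv M ρ).fn (A.evalEnv N ρ) := rfl

theorem evalEnv_lam (M : Tm S₀ S₂ (α :: Γ) β) (p : KK A.QΩ α) :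
    (A.evalEnv (.lam M) ρ).fn p = A.evalEnv M (Env.cons p ρ) := rfl

end Clauses

end TAC

end LambdaY

/-!
The value of a closed term `M` of type `0` is compared with the values of the truncations of its
Böhm tree in both directions.

*The value is a lower bound* (`TAC.eval_le_approx`). The model is sound for `βδ`-reduction
(`TAC.eval_reduces`), the `δ` rule because `Fix(f)` is a fixpoint of `f`. Hence, if `M` is solvable,
its value is computed from the root of its Böhm tree and from the values of the subterms below it,
and induction on the depth applies. If `M` is unsolvable, its value has to be `(⊥, Q_Ω)`, the only
element of `𝒦₀` whose projection to `𝒟₀` is `⊥`. This is adequacy of the projection to `𝒟`, a model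
with least fixpoints: a logical relation `Computes` between `𝒟` and closed terms, closed under
suprema, shows that a term with a value other than `⊥` is solvable.

*The value is above some truncation* (`TAC.exists_approx_le_eval`). The logical relation
`TAC.Dominates` between `𝒦` and closed terms says at the type `0` that `p` is above the value of
some truncation of the Böhm tree of the term. At function types it asks moreover that the
projections to `𝒟` are ordered. The point is the constant `Y`. In a finite model `Fix(f)` is an
iterate
`fⁿ(fix(f̄)↑)`, and the step from `n` to `n + 1` is the `δ` rule. The case `n = 0` is
`TAC.Dominates.up`: the projection of the value of `Y N` is a least fixpoint, below `fix(f̄)`, and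
any term whose value projects below `d` is dominated by `d↑`. At the type `0` this is
trivial when `d = ⊤`; when `d = ⊥`, the term is unsolvable or has a head normal form with head `Ω`,
and the truncation at depth `1` already has the value `(⊥, Q_Ω)`. The constants `ω` and `Ω` are
covered by the same lemma, being interpreted as `⊤↑` and `⊥↑`.

The relation `TAC.Dominates` has to be invariant under expansion of the term, so Böhm trees have to
be invariant under reduction. As they are built from an arbitrary choice of head normal forms, this
needs the confluence of `βδ`-reduction, obtained from the diamond property of parallel reduction,
and the fact that the reducts of a head normal form differ from it in the arguments only.
-/

namespace LambdaY

universe u v w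

section Reduction

variable {S₀ : Type u} {S₂ : Type v}

/-! ### Renaming and substitution -/

/-- The substitution which extends `s` by the term `N` for the last variable. -/
def Subst.cons {Γ Δ : Ctx} {β : Ty} (N : Tm S₀ S₂ Δ β) (s : Subst S₀ S₂ Γ Δ) :
    Subst S₀ S₂ (β :: Γ) Δ
  | _, .zero => N
  | _, .succ x => s _ x

theorem Tm.rename_rename {Γ Δ Θ : Ctx} {α : Ty} (r : Ren Γ Δ) (r' : Ren Δ Θ) (M : Tm S₀ S₂ Γ α) :
    (M.rename r).rename r' = M.rename fun β x => r' β (r β x) := by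
  induction M generalizing Δ Θ with
  | var x => rfl
  | cst c => rfl
  | fixY α => rfl
  | app M N ihM ihN => simp only [Tm.rename, ihM, ihN]
  | lam M ih =>
    simp only [Tm.rename, ih]
    congr 2
    funext β x
    cases x <;> rfl

theorem Tm.subst_rename {Γ Δ Θ : Ctx} {α : Ty} (r : Ren Γ Δ) (s : Subst S₀ S₂ Δ Θ)
    (M : Tm S₀ S₂ Γ α) : (M.rename r).subst s = M.subst fun β x => s β (r β x) := by
  induction M generalizing Δ Θ with
  | var x => rfl
  | cst c => rfl
  | fixY α => rfl
  | app M N ihM ihN => simp only [Tm.rename, Tm.subst, ihM, ihN]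
  | lam M ih =>
    simp only [Tm.rename, Tm.subst, ih]
    congr 2
    funext β x
    cases x <;> rfl

theorem Tm.rename_subst {Γ Δ Θ : Ctx} {α : Ty} (s : Subst S₀ S₂ Γ Δ) (r : Ren Δ Θ)
    (M : Tm S₀ S₂ Γ α) : (M.subst s).rename r = M.subst fun β x => (s β x).rename r := by
  induction M generalizing Δ Θ with
  | var x => rfl
  | cst c => rfl
  | fixY α => rfl
  | app M N ihM ihN => simp only [Tm.rename, Tm.subst, ihM, ihN]
  | lam M ih =>
    simp only [Tm.rename, Tm.subst, ih]
    congr 2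
    funext β x
    cases x with
    | zero => rfl
    | succ x => simp only [Subst.lift, Tm.rename_rename, Ren.lift]

theorem Tm.subst_subst {Γ Δ Θ : Ctx} {α : Ty} (s : Subst S₀ S₂ Γ Δ) (s' : Subst S₀ S₂ Δ Θ)
    (M : Tm S₀ S₂ Γ α) : (M.subst s).subst s' = M.subst fun β x => (s β x).subst s' := by
  induction M generalizing Δ Θ with
  | var x => rfl
  | cst c => rfl
  | fixY α => rfl
  | app M N ihM ihN => simp only [Tm.subst, ihM, ihN]
  | lam M ih =>
    simp only [Tm.subst, ih]
    congr 2
    funext β x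
    cases x with
    | zero => rfl
    | succ x => simp only [Subst.lift, Tm.subst_rename, Tm.rename_subst]

theorem Tm.subst_var {Γ : Ctx} {α : Ty} (M : Tm S₀ S₂ Γ α) : M.subst (fun _ x => .var x) = M := by
  induction M with
  | var x => rfl
  | cst c => rfl
  | fixY α => rfl
  | app M N ihM ihN => simp only [Tm.subst, ihM, ihN]
  | @lam Γ α β M ih =>
    have h : Subst.lift (fun _ x => .var x) = fun (γ : Ty) (x : Var (α :: Γ) γ) =>
        (.var x : Tm S₀ S₂ (α :: Γ) γ) := by
      funext γ x
      cases x <;> rfl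
    simp only [Tm.subst, h, ih]

theorem Tm.subst_single_rename {Γ Δ : Ctx} {α β : Ty} (M : Tm S₀ S₂ (β :: Γ) α)
    (N : Tm S₀ S₂ Γ β) (r : Ren Γ Δ) :
    (M.subst (Subst.single N)).rename r = (M.rename r.lift).subst (Subst.single (N.rename r)) := by
  rw [Tm.rename_subst, Tm.subst_rename]
  congr 1
  funext γ x
  cases x <;> rfl

theorem Tm.subst_lift_single {Γ Δ : Ctx} {α β : Ty} (M : Tm S₀ S₂ (β :: Γ) α)
    (N : Tm S₀ S₂ Δ β) (s : Subst S₀ S₂ Γ Δ) :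
    (M.subst s.lift).subst (Subst.single N) = M.subst (Subst.cons N s) := by
  rw [Tm.subst_subst]
  congr 1
  funext γ x
  cases x with
  | zero => rfl
  | succ x =>
    simp only [Subst.lift, Subst.cons, Tm.subst_rename]
    exact Tm.subst_var _

theorem Tm.subst_single_subst {Γ Δ : Ctx} {α β : Ty} (M : Tm S₀ S₂ (β :: Γ) α)
    (N : Tm S₀ S₂ Γ β) (s : Subst S₀ S₂ Γ Δ) :
    (M.subst (Subst.single N)).subst s = (M.subst s.lift).subst (Subst.single (N.subst s)) := by
  rw [Tm.subst_lift_single, Tm.subst_subst]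
  congr 1
  funext γ x
  cases x <;> rfl

/-! ### Confluence -/

theorem Reduces.app {Γ : Ctx} {α β : Ty} {M M' : Tm S₀ S₂ Γ (α ⇒ β)} {N N' : Tm S₀ S₂ Γ α}
    (h : Reduces M M') (h' : Reduces N N') : Reduces (.app M N) (.app M' N') :=
  (Relation.ReflTransGen.lift (fun M => Tm.app M N) (fun _ _ => Step.appL N) _ _ h).trans
    (Relation.ReflTransGen.lift (fun N => Tm.app M' N) (fun _ _ => Step.appR M') _ _ h')

theorem Reduces.lam {Γ : Ctx} {α β : Ty} {M M' : Tm S₀ S₂ (α :: Γ) β} (h : Reduces M M') :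
    Reduces (.lam M : Tm S₀ S₂ Γ (α ⇒ β)) (.lam M') :=
  Relation.ReflTransGen.lift Tm.lam (fun _ _ => Step.lam) _ _ h

/-- Parallel `βδ`-reduction: the simultaneous contraction of some of the redexes of a term. -/
inductive Par : {Γ : Ctx} → {α : Ty} → Tm S₀ S₂ Γ α → Tm S₀ S₂ Γ α → Prop
  | var {Γ : Ctx} {α : Ty} (x : Var Γ α) : Par (.var x) (.var x)
  | cst {Γ : Ctx} {α : Ty} (c : Cst S₀ S₂ α) : Par (.cst c : Tm S₀ S₂ Γ α) (.cst c)
  | fixY {Γ : Ctx} (α : Ty) : Par (.fixY α : Tm S₀ S₂ Γ _) (.fixY α)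
  | app {Γ : Ctx} {α β : Ty} {M M' : Tm S₀ S₂ Γ (α ⇒ β)} {N N' : Tm S₀ S₂ Γ α} :
      Par M M' → Par N N' → Par (.app M N) (.app M' N')
  | lam {Γ : Ctx} {α β : Ty} {M M' : Tm S₀ S₂ (α :: Γ) β} : Par M M' → Par (.lam M) (.lam M')
  | beta {Γ : Ctx} {α β : Ty} {M M' : Tm S₀ S₂ (α :: Γ) β} {N N' : Tm S₀ S₂ Γ α} :
      Par M M' → Par N N' → Par (.app (.lam M) N) (M'.subst (Subst.single N'))
  | delta {Γ : Ctx} {α : Ty} {M M' : Tm S₀ S₂ Γ (α ⇒ α)} :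
      Par M M' → Par (.app (.fixY α) M) (.app M' (.app (.fixY α) M'))

theorem Par.refl {Γ : Ctx} {α : Ty} (M : Tm S₀ S₂ Γ α) : Par M M := by
  induction M with
  | var x => exact .var x
  | cst c => exact .cst c
  | fixY α => exact .fixY α
  | app M N ihM ihN => exact .app ihM ihN
  | lam M ih => exact .lam ih

theorem Step.par {Γ : Ctx} {α : Ty} {M N : Tm S₀ S₂ Γ α} (h : Step M N) : Par M N := by
  induction h with
  | beta M N => exact .beta (.refl M) (.refl N)
  | delta M => exact .delta (.refl M)
  | appL N _ ih => exact .app ih (.refl N)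
  | appR M _ ih => exact .app (.refl M) ih
  | lam _ ih => exact .lam ih

theorem Par.reduces {Γ : Ctx} {α : Ty} {M N : Tm S₀ S₂ Γ α} (h : Par M N) : Reduces M N := by
  induction h with
  | var x => exact .refl
  | cst c => exact .refl
  | fixY α => exact .refl
  | app _ _ ihM ihN => exact ihM.app ihN
  | lam _ ih => exact ih.lam
  | beta _ _ ihM ihN => exact (ihM.lam.app ihN).tail (.beta _ _)
  | delta _ ih => exact (Reduces.app .refl ih).tail (.delta _)

theorem Par.rename {Γ Δ : Ctx} {α : Ty} {M M' : Tm S₀ S₂ Γ α} (h : Par M M') (r : Ren Γ Δ) :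
    Par (M.rename r) (M'.rename r) := by
  induction h generalizing Δ with
  | var x => exact .var _
  | cst c => exact .cst c
  | fixY α => exact .fixY α
  | app _ _ ihM ihN => exact .app (ihM r) (ihN r)
  | lam _ ih => exact .lam (ih r.lift)
  | beta _ _ ihM ihN =>
    rw [Tm.subst_single_rename]
    exact .beta (ihM r.lift) (ihN r)
  | delta _ ih => exact .delta (ih r)

theorem Par.lift {Γ Δ : Ctx} {β : Ty} {s s' : Subst S₀ S₂ Γ Δ} (hs : ∀ α x, Par (s α x) (s' α x))
    (α : Ty) (x : Var (β :: Γ) α) : Par (s.lift α x) (s'.lift α x) := by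
  cases x with
  | zero => exact .var _
  | succ x => exact (hs _ x).rename _

theorem Par.subst {Γ Δ : Ctx} {α : Ty} {M M' : Tm S₀ S₂ Γ α} (h : Par M M')
    {s s' : Subst S₀ S₂ Γ Δ} (hs : ∀ α x, Par (s α x) (s' α x)) :
    Par (M.subst s) (M'.subst s') := by
  induction h generalizing Δ with
  | var x => exact hs _ x
  | cst c => exact .cst c
  | fixY α => exact .fixY α
  | app _ _ ihM ihN => exact .app (ihM hs) (ihN hs)
  | lam _ ih => exact .lam (ih (Par.lift hs))
  | beta _ _ ihM ihN =>
    rw [Tm.subst_single_subst]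
    exact .beta (ihM (Par.lift hs)) (ihN hs)
  | delta _ ih => exact .delta (ih hs)

theorem Par.subst_single {Γ : Ctx} {α β : Ty} {M M' : Tm S₀ S₂ (β :: Γ) α} {N N' : Tm S₀ S₂ Γ β}
    (hM : Par M M') (hN : Par N N') :
    Par (M.subst (Subst.single N)) (M'.subst (Subst.single N')) := by
  refine hM.subst fun γ x => ?_
  cases x with
  | zero => exact hN
  | succ x => exact .var x

theorem Par.lam_inv {Γ : Ctx} {α β : Ty} {M : Tm S₀ S₂ (α :: Γ) β} {N : Tm S₀ S₂ Γ (α ⇒ β)}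
    (h : Par (.lam M) N) : ∃ M', N = .lam M' ∧ Par M M' := by
  cases h with
  | lam h => exact ⟨_, rfl, h⟩

theorem Par.diamond {Γ : Ctx} {α : Ty} {M M₁ M₂ : Tm S₀ S₂ Γ α} (h₁ : Par M M₁) (h₂ : Par M M₂) :
    ∃ N, Par M₁ N ∧ Par M₂ N := by
  induction h₁ with
  | var x => exact ⟨_, h₂, .refl _⟩
  | cst c => exact ⟨_, h₂, .refl _⟩
  | fixY α => exact ⟨_, h₂, .refl _⟩
  | lam _ ih =>
    cases h₂ with
    | lam h₂ =>
      obtain ⟨N, h, h'⟩ := ih h₂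
      exact ⟨_, .lam h, .lam h'⟩
  | app hM hN ihM ihN =>
    cases h₂ with
    | app hM' hN' =>
      obtain ⟨P, hP, hP'⟩ := ihM hM'
      obtain ⟨R, hR, hR'⟩ := ihN hN'
      exact ⟨_, .app hP hR, .app hP' hR'⟩
    | beta hM' hN' =>
      obtain ⟨P, hP, hP'⟩ := ihM (.lam hM')
      obtain ⟨R, hR, hR'⟩ := ihN hN'
      obtain ⟨M₁, rfl, -⟩ := hM.lam_inv
      obtain ⟨P, rfl, -⟩ := hP.lam_inv
      cases hP with
      | lam hP =>
        cases hP' with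
        | lam hP' => exact ⟨_, .beta hP hR, hP'.subst_single hR'⟩
    | delta hM' =>
      obtain ⟨R, hR, hR'⟩ := ihN hM'
      cases hM
      exact ⟨_, .delta hR, .app hR' (.app (.fixY _) hR')⟩
  | beta hM hN ihM ihN =>
    cases h₂ with
    | app hM' hN' =>
      obtain ⟨M₁, rfl, hM₁⟩ := hM'.lam_inv
      obtain ⟨P, hP, hP'⟩ := ihM hM₁
      obtain ⟨R, hR, hR'⟩ := ihN hN'
      exact ⟨_, hP.subst_single hR, .beta hP' hR'⟩
    | beta hM' hN' =>
      obtain ⟨P, hP, hP'⟩ := ihM hM'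
      obtain ⟨R, hR, hR'⟩ := ihN hN'
      exact ⟨_, hP.subst_single hR, hP'.subst_single hR'⟩
  | delta hM ih =>
    cases h₂ with
    | app hY hM' =>
      obtain ⟨R, hR, hR'⟩ := ih hM'
      cases hY
      exact ⟨_, .app hR (.app (.fixY _) hR), .delta hR'⟩
    | delta hM' =>
      obtain ⟨R, hR, hR'⟩ := ih hM'
      exact ⟨_, .app hR (.app (.fixY _) hR), .app hR' (.app (.fixY _) hR')⟩

theorem reduces_iff_reflTransGen_par {Γ : Ctx} {α : Ty} {M N : Tm S₀ S₂ Γ α} :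
    Reduces M N ↔ Relation.ReflTransGen Par M N := by
  constructor
  · exact Relation.ReflTransGen.mono (fun _ _ => Step.par) _ _
  · intro h
    induction h with
    | refl => exact .refl
    | tail _ h ih => exact ih.trans h.reduces

theorem Reduces.confluent {Γ : Ctx} {α : Ty} {M M₁ M₂ : Tm S₀ S₂ Γ α} (h₁ : Reduces M M₁)
    (h₂ : Reduces M M₂) : ∃ N, Reduces M₁ N ∧ Reduces M₂ N := by
  obtain ⟨N, h, h'⟩ := Relation.church_rosser (r := Par)
    (fun _ _ _ h h' => (Par.diamond h h').imp fun _ hd => ⟨.single hd.1, .single hd.2⟩)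
    (reduces_iff_reflTransGen_par.1 h₁) (reduces_iff_reflTransGen_par.1 h₂)
  exact ⟨N, reduces_iff_reflTransGen_par.2 h, reduces_iff_reflTransGen_par.2 h'⟩

/-! ### Head normal forms and the Böhm tree -/

/-- Spines with the same head, and with arguments reducing to each other one by one. -/
inductive Spine.ArgReduces {Γ : Ctx} : {α : Ty} → Spine S₀ S₂ (Tm S₀ S₂) Γ α →
    Spine S₀ S₂ (Tm S₀ S₂) Γ α → Prop
  | refl {α : Ty} (s : Spine S₀ S₂ (Tm S₀ S₂) Γ α) : ArgReduces s s
  | app {α β : Ty} {s s' : Spine S₀ S₂ (Tm S₀ S₂) Γ (α ⇒ β)} {N N' : Tm S₀ S₂ Γ α} :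
      ArgReduces s s' → Reduces N N' → ArgReduces (.app s N) (.app s' N')

/-- Head normal forms with the same label, and with arguments reducing to each other one by one. -/
inductive Hnf.ArgReduces : {Γ : Ctx} → {α : Ty} → Hnf S₀ S₂ (Tm S₀ S₂) Γ α →
    Hnf S₀ S₂ (Tm S₀ S₂) Γ α → Prop
  | spine {Γ : Ctx} {α : Ty} {s s' : Spine S₀ S₂ (Tm S₀ S₂) Γ α} :
      s.ArgReduces s' → ArgReduces (.spine s) (.spine s')
  | fixY {Γ : Ctx} (α : Ty) : ArgReduces (.fixY α : Hnf S₀ S₂ _ Γ _) (.fixY α)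
  | lam {Γ : Ctx} {α β : Ty} {h h' : Hnf S₀ S₂ (Tm S₀ S₂) (α :: Γ) β} :
      ArgReduces h h' → ArgReduces (.lam h) (.lam h')

theorem Spine.ArgReduces.map_eq {X : Ctx → Ty → Type w} {f : ∀ Γ α, Tm S₀ S₂ Γ α → X Γ α}
    (hf : ∀ Γ α M N, Reduces M N → f Γ α M = f Γ α N) {Γ : Ctx} {α : Ty}
    {s s' : Spine S₀ S₂ (Tm S₀ S₂) Γ α} (h : s.ArgReduces s') : s.map f = s'.map f := by
  induction h with
  | refl s => rfl
  | app _ hN ih => simp only [Spine.map, ih, hf _ _ _ _ hN]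

theorem Hnf.ArgReduces.map_eq {X : Ctx → Ty → Type w} {f : ∀ Γ α, Tm S₀ S₂ Γ α → X Γ α}
    (hf : ∀ Γ α M N, Reduces M N → f Γ α M = f Γ α N) {Γ : Ctx} {α : Ty}
    {s s' : Hnf S₀ S₂ (Tm S₀ S₂) Γ α} (h : s.ArgReduces s') : s.map f = s'.map f := by
  induction h with
  | spine h => simp only [Hnf.map, h.map_eq hf]
  | fixY α => rfl
  | lam _ ih => simp only [Hnf.map, ih]

theorem Spine.toTm_ne_lam {Γ : Ctx} {α β : Ty} (s : Spine S₀ S₂ (Tm S₀ S₂) Γ (α ⇒ β))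
    (M : Tm S₀ S₂ (α :: Γ) β) : s.toTm ≠ .lam M := by
  cases s <;> exact fun h => nomatch h

theorem Spine.toTm_ne_fixY {Γ : Ctx} {α : Ty} (s : Spine S₀ S₂ (Tm S₀ S₂) Γ ((α ⇒ α) ⇒ α)) :
    s.toTm ≠ .fixY α := by
  intro h
  cases s <;> exact nomatch h

theorem Spine.toTm_injective {Γ : Ctx} {α : Ty} {s s' : Spine S₀ S₂ (Tm S₀ S₂) Γ α}
    (h : s.toTm = s'.toTm) : s = s' := by
  induction s with
  | var x =>
    cases s' with
    | var y => cases h; rfl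
    | cst c => cases h
    | app s' N => cases h
  | cst c =>
    cases s' with
    | var y => cases h
    | cst c => cases h; rfl
    | app s' N => cases h
  | app s N ih =>
    cases s' with
    | var y => cases h
    | cst c => cases h
    | app s' N' =>
      simp only [Spine.toTm, Tm.app.injEq] at h
      obtain ⟨rfl, h, h'⟩ := h
      rw [ih (eq_of_heq h), eq_of_heq h']

theorem Hnf.toTm_injective {Γ : Ctx} {α : Ty} {h h' : Hnf S₀ S₂ (Tm S₀ S₂) Γ α}
    (e : h.toTm = h'.toTm) : h = h' := by
  induction h with
  | spine s =>
    cases h' with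
    | spine s' => rw [Spine.toTm_injective e]
    | fixY α => exact absurd e s.toTm_ne_fixY
    | lam h' => exact absurd e (s.toTm_ne_lam _)
  | fixY α =>
    generalize ht : (Hnf.fixY α : Hnf S₀ S₂ (Tm S₀ S₂) _ _).toTm = t at e
    cases h' with
    | spine s' => exact absurd (ht.trans e).symm s'.toTm_ne_fixY
    | fixY α => rfl
    | lam h' => exact nomatch ht.trans e
  | lam h ih =>
    cases h' with
    | spine s' => exact absurd e.symm (s'.toTm_ne_lam _)
    | fixY α => exact nomatch e
    | lam h' =>
      simp only [Hnf.toTm, Tm.lam.injEq] at e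
      rw [ih e]

theorem Spine.ArgReduces.trans {Γ : Ctx} {α : Ty} {s₁ s₂ s₃ : Spine S₀ S₂ (Tm S₀ S₂) Γ α}
    (h : s₁.ArgReduces s₂) (h' : s₂.ArgReduces s₃) : s₁.ArgReduces s₃ := by
  induction h with
  | refl s => exact h'
  | app h hN ih =>
    cases h' with
    | refl s => exact .app h hN
    | app h' hN' => exact .app (ih h') (hN.trans hN')

theorem Hnf.ArgReduces.refl {Γ : Ctx} {α : Ty} (h : Hnf S₀ S₂ (Tm S₀ S₂) Γ α) :
    h.ArgReduces h := by
  induction h with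
  | spine s => exact .spine (.refl s)
  | fixY α => exact .fixY α
  | lam h ih => exact .lam ih

theorem Hnf.ArgReduces.trans {Γ : Ctx} {α : Ty} {h₁ h₂ h₃ : Hnf S₀ S₂ (Tm S₀ S₂) Γ α}
    (h : h₁.ArgReduces h₂) (h' : h₂.ArgReduces h₃) : h₁.ArgReduces h₃ := by
  induction h with
  | spine h =>
    cases h' with
    | spine h' => exact .spine (h.trans h')
  | fixY α => exact h'
  | lam h ih =>
    cases h' with
    | lam h' => exact .lam (ih h')

theorem Spine.exists_of_step {Γ : Ctx} {α : Ty} (s : Spine S₀ S₂ (Tm S₀ S₂) Γ α)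
    {M : Tm S₀ S₂ Γ α} (h : Step s.toTm M) : ∃ s', M = s'.toTm ∧ s.ArgReduces s' := by
  induction s with
  | var x => exact nomatch h
  | cst c => exact nomatch h
  | app s N ih =>
    simp only [Spine.toTm] at h
    generalize hs : s.toTm = P at h
    cases h with
    | beta P N => exact absurd hs (s.toTm_ne_lam P)
    | delta N => exact absurd hs s.toTm_ne_fixY
    | appL N h =>
      obtain ⟨s', rfl, hs'⟩ := ih (hs ▸ h)
      exact ⟨.app s' N, rfl, .app hs' .refl⟩
    | appR P h =>
      subst hs
      exact ⟨.app s _, rfl, .app (.refl s) (.single h)⟩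

theorem Hnf.exists_of_step {Γ : Ctx} {α : Ty} (h : Hnf S₀ S₂ (Tm S₀ S₂) Γ α)
    {M : Tm S₀ S₂ Γ α} (hM : Step h.toTm M) : ∃ h', M = h'.toTm ∧ h.ArgReduces h' := by
  induction h with
  | spine s =>
    obtain ⟨s', rfl, hs⟩ := s.exists_of_step hM
    exact ⟨.spine s', rfl, .spine hs⟩
  | fixY α =>
    exact nomatch hM
  | lam h ih =>
    simp only [Hnf.toTm] at hM
    generalize ht : h.toTm = t at hM
    cases hM with
    | lam hM =>
      obtain ⟨h', rfl, hh⟩ := ih (ht ▸ hM)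
      exact ⟨.lam h', rfl, .lam hh⟩

theorem Hnf.exists_of_reduces {Γ : Ctx} {α : Ty} (h : Hnf S₀ S₂ (Tm S₀ S₂) Γ α)
    {M : Tm S₀ S₂ Γ α} (hM : Reduces h.toTm M) : ∃ h', M = h'.toTm ∧ h.ArgReduces h' := by
  induction hM with
  | refl => exact ⟨h, rfl, .refl h⟩
  | tail _ hM ih =>
    obtain ⟨h', rfl, hh⟩ := ih
    obtain ⟨h'', rfl, hh'⟩ := h'.exists_of_step hM
    exact ⟨h'', rfl, hh.trans hh'⟩

theorem Solvable.of_reduces {Γ : Ctx} {α : Ty} {M N : Tm S₀ S₂ Γ α} (h : Reduces M N) :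
    Solvable N → Solvable M :=
  fun ⟨k, hk⟩ => ⟨k, h.trans hk⟩

theorem Solvable.reduct {Γ : Ctx} {α : Ty} {M N : Tm S₀ S₂ Γ α} (h : Reduces M N) :
    Solvable M → Solvable N := by
  rintro ⟨k, hk⟩
  obtain ⟨P, hP, hP'⟩ := h.confluent hk
  obtain ⟨k', rfl, -⟩ := k.exists_of_reduces hP'
  exact ⟨k', hP⟩

/-- All head normal forms of a term have the same label, and the same arguments up to
`βδ`-equality; so they agree once a reduction invariant is applied to the arguments. -/
theorem Hnf.map_eq_of_reduces {X : Ctx → Ty → Type w} {f : ∀ Γ α, Tm S₀ S₂ Γ α → X Γ α}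
    (hf : ∀ Γ α M N, Reduces M N → f Γ α M = f Γ α N) {Γ : Ctx} {α : Ty} {M : Tm S₀ S₂ Γ α}
    {h h' : Hnf S₀ S₂ (Tm S₀ S₂) Γ α} (hh : Reduces M h.toTm) (hh' : Reduces M h'.toTm) :
    h.map f = h'.map f := by
  obtain ⟨P, hP, hP'⟩ := hh.confluent hh'
  obtain ⟨k, rfl, hk⟩ := h.exists_of_reduces hP
  obtain ⟨k', e, hk'⟩ := h'.exists_of_reduces hP'
  cases Hnf.toTm_injective e
  rw [hk.map_eq hf, hk'.map_eq hf]

theorem reduces_boehmRoot {Γ : Ctx} {α : Ty} {M : Tm S₀ S₂ Γ α} (h : Solvable M) :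
    Reduces M (boehmRoot M).toTm := by
  rw [boehmRoot, dif_pos h]
  exact h.choose_spec

/-- Böhm trees are invariant under reduction. -/
theorem boehmPrefix_eq_of_reduces (n : ℕ) {Γ : Ctx} {α : Ty} {M N : Tm S₀ S₂ Γ α}
    (h : Reduces M N) : boehmPrefix n Γ α M = boehmPrefix n Γ α N := by
  induction n generalizing Γ α M N with
  | zero => rfl
  | succ n ih =>
    by_cases hM : Solvable M
    · exact Hnf.map_eq_of_reduces (fun _ _ _ _ => ih) (reduces_boehmRoot hM)
        (h.trans (reduces_boehmRoot (hM.reduct h)))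
    · have hN : ¬ Solvable N := fun hN => hM (hN.of_reduces h)
      have e : boehmRoot M = boehmRoot N := by
        rw [boehmRoot, boehmRoot, dif_neg hM, dif_neg hN]
      exact congrArg (Hnf.map (boehmPrefix n)) e

/-- The Böhm tree may be computed with any head normal form. -/
theorem boehmPrefix_succ_of_reduces (n : ℕ) {Γ : Ctx} {α : Ty} {M : Tm S₀ S₂ Γ α}
    {h : Hnf S₀ S₂ (Tm S₀ S₂) Γ α} (hM : Reduces M h.toTm) :
    boehmPrefix (n + 1) Γ α M = h.map (boehmPrefix n) :=
  Hnf.map_eq_of_reduces (fun _ _ _ _ => boehmPrefix_eq_of_reduces n)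
    (reduces_boehmRoot ⟨h, hM⟩) hM

end Reduction

/-! ### The projection and the embedding between `𝒦` and `𝒟` -/

section Galois

variable {Q : Type u} {W : Set Q}

theorem KK.ext {α β : Ty} {f g : KK W (α ⇒ β)} (h : ∀ p, f.fn p = g.fn p) : f = g :=
  Subtype.ext (OrderHom.ext _ _ (funext h))

theorem bar_up {α : Ty} (d : DD W α) : bar (up d) = d := bar_eq (LL_up d)

theorem bar_fn {α β : Ty} (f : KK W (α ⇒ β)) (p : KK W α) :
    bar (f.fn p) = DD.fn (bar f) (bar p) := bar_eq (LL_bar f _ _ (LL_bar p))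

theorem fn_up {α β : Ty} (d : DD W (α ⇒ β)) (p : KK W α) :
    (up d).fn p = up (DD.fn d (bar p)) := by
  refine le_antisymm (le_up_iff.2 ?_) ?_
  · rw [bar_fn, bar_up]
  · let f : KK W (α ⇒ β) := KK.mk
      ⟨fun p => up (DD.fn d (bar p)), fun _ _ h => up_mono ((DD.fn d).monotone (bar_mono h))⟩
      ⟨DD.fn d, fun g e h => by
        rw [← bar_eq h]
        exact LL_up _⟩
    have hf : f ≤ up d := (up_spec d).2 fun g e h => by
      rw [← bar_eq h]
      exact LL_up _
    exact hf p

theorem bar_base (p : KK W .base) : bar p = (p.1.1 : Bool) :=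
  bar_eq (show LL W .base p p.1.1 from rfl)

theorem eq_bbot_of_bar_le {p : KK W .base} (h : bar p ≤ ⊥) : p = bbot W .base := by
  rw [bar_base] at h
  have hc : p.1.1 = false := le_bot_iff.1 h
  rcases p.2 with h' | h'
  · exact absurd (h'.symm.trans hc) Bool.noConfusion
  · exact Subtype.ext h'

theorem bbot_eq_up (α : Ty) : bbot W α = up ⊥ := by
  induction α with
  | base => exact (eq_bbot_of_bar_le (bar_up ⊥).le).symm
  | arr α β _ ih =>
    refine KK.ext fun p => ?_
    rw [fn_up]
    exact ih

theorem bar_fixK [Finite Q] {α : Ty} (d : DD W (α ⇒ α)) : DD.fn (bar (fixK W α)) d = lfpD d := by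
  have h := bar_fn (fixK W α) (up d)
  rw [bar_up] at h
  rw [← h]
  have h' : bar ((fixK W α).fn (up d)) = lfpD (bar (up d)) := bar_eq (LL_fixVal _)
  rw [h', bar_up]

theorem exists_fixVal_eq [Finite Q] {α : Ty} (f : KK W (α ⇒ α)) : ∃ n, fixVal f = fixSeq f n :=
  (exists_eq_fixSeq_isGLB f).imp fun _ h => (isGLB_fixVal f).unique h

theorem fixSeq_succ {α : Ty} (f : KK W (α ⇒ α)) (n : ℕ) : fixSeq f (n + 1) = f.fn (fixSeq f n) :=
  Function.iterate_succ_apply' _ _ _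

theorem fn_fixVal [Finite Q] {α : Ty} (f : KK W (α ⇒ α)) : f.fn (fixVal f) = fixVal f := by
  obtain ⟨n, hn⟩ := exists_fixVal_eq f
  refine le_antisymm ?_ ?_
  · rw [hn, ← fixSeq_succ]
    exact fixSeq_antitone f n.le_succ
  · conv_rhs => rw [hn, ← fixSeq_succ]
    exact (isGLB_fixVal f).1 ⟨n + 1, rfl⟩

end Galois

/-! ### Soundness of the model -/

section Soundness

variable {Q : Type u} [Finite Q] {S₀ : Type v} {S₂ : Type w} (A : TAC Q S₀ S₂)

namespace TAC

theorem evalEnv_rename {Γ Δ : Ctx} {α : Ty} (M : Tm S₀ S₂ Γ α) (r : Ren Γ Δ) (ρ : Env A.QΩ Δ) :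
    A.evalEnv (M.rename r) ρ = A.evalEnv M fun β x => ρ β (r β x) := by
  induction M generalizing Δ with
  | var x => rfl
  | cst c => rfl
  | fixY α => rfl
  | app M N ihM ihN => simp only [Tm.rename, evalEnv_app, ihM, ihN]
  | lam M ih =>
    refine KK.ext fun p => ?_
    simp only [Tm.rename, evalEnv_lam, ih]
    congr 1
    funext β x
    cases x <;> rfl

theorem evalEnv_subst {Γ Δ : Ctx} {α : Ty} (M : Tm S₀ S₂ Γ α) (s : Subst S₀ S₂ Γ Δ)
    (ρ : Env A.QΩ Δ) : A.evalEnv (M.subst s) ρ = A.evalEnv M fun β x => A.evalEnv (s β x) ρ := by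
  induction M generalizing Δ with
  | var x => rfl
  | cst c => rfl
  | fixY α => rfl
  | app M N ihM ihN => simp only [Tm.subst, evalEnv_app, ihM, ihN]
  | lam M ih =>
    refine KK.ext fun p => ?_
    simp only [Tm.subst, evalEnv_lam, ih]
    congr 1
    funext β x
    cases x with
    | zero => rfl
    | succ x => exact A.evalEnv_rename _ _ _

theorem evalEnv_step {Γ : Ctx} {α : Ty} {M N : Tm S₀ S₂ Γ α} (h : Step M N) (ρ : Env A.QΩ Γ) :
    A.evalEnv M ρ = A.evalEnv N ρ := by
  induction h with
  | beta M N =>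
    rw [evalEnv_subst, evalEnv_app, evalEnv_lam]
    congr 1
    funext β x
    cases x <;> rfl
  | delta M => exact (fn_fixVal (A.evalEnv M ρ)).symm
  | appL N _ ih => rw [evalEnv_app, evalEnv_app, ih]
  | appR M _ ih => rw [evalEnv_app, evalEnv_app, ih]
  | lam _ ih =>
    refine KK.ext fun p => ?_
    rw [evalEnv_lam, evalEnv_lam, ih]

theorem eval_reduces {α : Ty} {M N : Tm S₀ S₂ [] α} (h : Reduces M N) :
    A.eval M = A.eval N := by
  induction h with
  | refl => rfl
  | tail _ h ih => exact ih.trans (A.evalEnv_step h _)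

theorem eval_app {α β : Ty} (M : Tm S₀ S₂ [] (α ⇒ β)) (N : Tm S₀ S₂ [] α) :
    A.eval (.app M N) = (A.eval M).fn (A.eval N) := rfl

/-- The projection to `𝒟` of the value of a term only depends on, and is monotone in, the
projections of the values of the variables. -/
theorem bar_evalEnv_mono {Γ : Ctx} {α : Ty} (M : Tm S₀ S₂ Γ α) {ρ ρ' : Env A.QΩ Γ}
    (h : ∀ β x, bar (ρ β x) ≤ bar (ρ' β x)) : bar (A.evalEnv M ρ) ≤ bar (A.evalEnv M ρ') := by
  obtain ⟨G, hG⟩ := (interp A.val M).2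
  have hb (ρ : Env A.QΩ Γ) : bar (A.evalEnv M ρ) = G fun β x => bar (ρ β x) :=
    bar_eq (hG _ _ fun _ _ => LL_bar _)
  rw [hb, hb]
  exact G.monotone h

end TAC

end Soundness

/-! ### Adequacy: closed terms with a value other than `⊥` are solvable -/

section Adequacy

variable {Q : Type u} {W : Set Q} {S₀ : Type v} {S₂ : Type w}

/-- The computability relation between elements of `𝒟` and closed terms: the logical relation
which at the type `0` says that a term with a value other than `⊥` is solvable. -/
def Computes : (α : Ty) → DD W α → Tm S₀ S₂ [] α → Prop
  | .base, d, M => d ≠ ⊥ → Solvable M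
  | .arr α β, d, M => ∀ e N, Computes α e N → Computes β (DD.fn d e) (.app M N)

theorem Computes.of_reduces {α : Ty} {d : DD W α} {M N : Tm S₀ S₂ [] α} (h : Reduces M N)
    (hN : Computes α d N) : Computes α d M := by
  induction α with
  | base => exact fun hd => (hN hd).of_reduces h
  | arr α β _ ih => exact fun e P hP => ih (h.app .refl) (hN e P hP)

theorem Computes.sSup {α : Ty} {M : Tm S₀ S₂ [] α} {D : Set (DD W α)}
    (h : ∀ d ∈ D, Computes α d M) : Computes α (sSup D) M := by
  induction α with
  | base =>
    intro hd
    have : ∃ d ∈ D, d ≠ ⊥ := by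
      by_contra! h0
      exact hd (sSup_eq_bot.2 h0)
    obtain ⟨d, hD, hd⟩ := this
    exact h d hD hd
  | arr α β _ ih =>
    intro e N hN
    have h1 : DD.fn (SupSet.sSup D) e = SupSet.sSup ((fun d => DD.fn d e) '' D) := by
      rw [sSup_image]
      exact OrderHom.sSup_apply D e
    rw [h1]
    refine ih ?_
    rintro _ ⟨d, hd, rfl⟩
    exact h d hd e N hN

theorem Computes.spine {α : Ty} (d : DD W α) (s : Spine S₀ S₂ (Tm S₀ S₂) [] α) :
    Computes α d s.toTm := by
  induction α with
  | base => exact fun _ => ⟨.spine s, .refl⟩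
  | arr α β _ ih => exact fun e N _ => ih _ (s.app N)

/-- Fixpoint induction: the elements that a term computes are closed under suprema. -/
theorem Computes.fixY {α : Ty} {d : DD W (α ⇒ α)} {M : Tm S₀ S₂ [] (α ⇒ α)}
    (h : Computes (α ⇒ α) d M) : Computes α (lfpD d) (.app (.fixY α) M) :=
  OrderHom.lfp_induction (DD.fn d) (p := fun e => Computes α e (.app (.fixY α) M))
    (fun e he _ => (h e _ he).of_reduces (.single (.delta M))) fun _ hD => Computes.sSup hD

/-- The fundamental lemma of the relation `Computes`. The value `d` of a bound variable is supplied
to the interpretation in `𝒦` as `d↑`, since `𝒟` has no interpretation of its own here. -/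
theorem TAC.computes_evalEnv [Finite Q] (A : TAC Q S₀ S₂) {Γ : Ctx} {α : Ty} (M : Tm S₀ S₂ Γ α)
    {ρ : Env A.QΩ Γ} {s : Subst S₀ S₂ Γ []}
    (h : ∀ β x, Computes β (bar (ρ β x)) (s β x)) :
    Computes α (bar (A.evalEnv M ρ)) (M.subst s) := by
  induction M with
  | var x => exact h _ x
  | cst c => exact Computes.spine _ (.cst c)
  | fixY α =>
    intro d N hN
    rw [evalEnv_fixY, bar_fixK]
    exact hN.fixY
  | app M N ihM ihN =>
    rw [evalEnv_app, bar_fn]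
    exact ihM h _ _ (ihN h)
  | lam M ih =>
    intro d N hN
    have h1 : DD.fn (bar (A.evalEnv (.lam M) ρ)) d = bar (A.evalEnv M (Env.cons (up d) ρ)) := by
      rw [← evalEnv_lam, bar_fn, bar_up]
    rw [h1]
    refine Computes.of_reduces (.single (.beta _ _)) ?_
    rw [Tm.subst_lift_single]
    refine ih fun γ x => ?_
    cases x with
    | zero => exact (bar_up d).symm ▸ hN
    | succ x => exact h _ x

theorem TAC.eval_eq_bbot_of_not_solvable [Finite Q] (A : TAC Q S₀ S₂) {M : Tm S₀ S₂ [] .base}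
    (h : ¬ Solvable M) : A.eval M = bbot A.QΩ .base := by
  refine eq_bbot_of_bar_le (le_bot_iff.2 (by_contra fun h0 => h ?_))
  have h1 := A.computes_evalEnv M (ρ := fun _ x => nomatch x) (s := fun _ x => .var x)
    (fun _ x => nomatch x)
  rw [Tm.subst_var] at h1
  exact h1 h0

end Adequacy

/-! ### The values of the truncated Böhm trees -/

section Approx

variable {S₀ : Type v} {S₂ : Type w}

/-- The closed spines headed by a letter of the tree signature. -/
inductive Spine.Letter {X : Ctx → Ty → Type*} : {α : Ty} → Spine S₀ S₂ X [] α → Prop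
  | leaf (c : S₀) : Letter (.cst (.leaf c))
  | node (a : S₂) : Letter (.cst (.node a))
  | node₁ (a : S₂) (x : X [] .base) : Letter (.app (.cst (.node a)) x)
  | node₂ (a : S₂) (x y : X [] .base) : Letter (.app (.app (.cst (.node a)) x) y)

theorem Spine.map_id {X : Ctx → Ty → Type*} {Γ : Ctx} {α : Ty} (s : Spine S₀ S₂ X Γ α) :
    s.map (fun _ _ x => x) = s := by
  induction s with
  | var x => rfl
  | cst c => rfl
  | app s x ih => simp only [Spine.map, ih]

variable {Q : Type u} [Finite Q] (A : TAC Q S₀ S₂)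

namespace TAC

/-- A closed spine headed by `ω` or `Ω` has the value `⊤↑` or `⊥↑`, whatever its arguments are. -/
theorem eval_spine_or_letter {X : Ctx → Ty → Type*} {α : Ty} (s : Spine S₀ S₂ X [] α) :
    (∀ f, A.eval (s.map f).toTm = up ⊤) ∨ (∀ f, A.eval (s.map f).toTm = up ⊥) ∨ s.Letter := by
  induction s with
  | var x => exact nomatch x
  | cst c =>
    cases c with
    | leaf c => exact .inr (.inr (.leaf c))
    | node a => exact .inr (.inr (.node a))
    | omegaCut => exact .inl fun _ => rfl
    | omegaDiv => exact .inr (.inl fun _ => bbot_eq_up _)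
  | app s x ih =>
    rcases ih with h | h | h
    · refine .inl fun f => ?_
      rw [Spine.map, Spine.toTm, eval_app, h f, fn_up]
      rfl
    · refine .inr (.inl fun f => ?_)
      rw [Spine.map, Spine.toTm, eval_app, h f, fn_up]
      rfl
    · cases h with
      | node a => exact .inr (.inr (.node₁ a x))
      | node₁ a y => exact .inr (.inr (.node₂ a y x))

/-- The value of the Böhm tree of `M` truncated at depth `n`. -/
noncomputable def approx (n : ℕ) (M : Tm S₀ S₂ [] .base) : KK A.QΩ .base :=
  A.eval ((boehmTree M).truncate n)

theorem approx_eq_of_reduces (n : ℕ) {M N : Tm S₀ S₂ [] .base} (h : Reduces M N) :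
    A.approx n M = A.approx n N :=
  congrArg (fun t => A.eval (Prefix.toTm n [] .base t)) (boehmPrefix_eq_of_reduces n h)

theorem approx_succ_spine (n : ℕ) {M : Tm S₀ S₂ [] .base} {s : Spine S₀ S₂ (Tm S₀ S₂) [] .base}
    (h : Reduces M s.toTm) : A.approx (n + 1) M =
      A.eval (s.map fun Γ α N => Prefix.toTm n Γ α (boehmPrefix n Γ α N)).toTm := by
  have h1 := boehmPrefix_succ_of_reduces n (h := .spine s) h
  have h2 : A.approx (n + 1) M = A.eval
      ((s.map (boehmPrefix n)).map (Prefix.toTm (S₀ := S₀) (S₂ := S₂) n)).toTm :=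
    congrArg (fun t => A.eval (Prefix.toTm (n + 1) [] .base t)) h1
  rw [h2, Spine.map_map]

theorem approx_succ_node (n : ℕ) {M N₁ N₂ : Tm S₀ S₂ [] .base} {a : S₂}
    (h : Reduces M (.app (.app (.cst (.node a)) N₁) N₂)) :
    A.approx (n + 1) M = A.nodeFun a (A.approx n N₁) (A.approx n N₂) :=
  A.approx_succ_spine n (s := .app (.app (.cst (.node a)) N₁) N₂) h

/-- The root of the Böhm tree of a closed term of type `0` is a letter of arity `2`, or else its
value is known from depth `1` on, and is that of the term. -/
theorem eval_eq_approx_or_node (M : Tm S₀ S₂ [] .base) :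
    (∀ n, A.approx (n + 1) M = A.eval M) ∨
      ∃ a N₁ N₂, Reduces M (.app (.app (.cst (.node a)) N₁) N₂) := by
  by_cases hM : Solvable M
  · obtain ⟨h, hM⟩ := hM
    cases h with
    | spine s =>
      have hM' : Reduces M s.toTm := hM
      have he : A.eval M = A.eval (s.map fun _ _ N => N).toTm := by
        rw [Spine.map_id, A.eval_reduces hM']
      rcases A.eval_spine_or_letter s with h | h | h
      · exact .inl fun n => by rw [A.approx_succ_spine n hM', he, h, h]
      · exact .inl fun n => by rw [A.approx_succ_spine n hM', he, h, h]
      · cases h with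
        | leaf c => exact .inl fun n => by rw [A.approx_succ_spine n hM', he]; rfl
        | node₂ a N₁ N₂ => exact .inr ⟨a, N₁, N₂, hM'⟩
  · refine .inl fun n => ?_
    rw [A.eval_eq_bbot_of_not_solvable hM]
    have h : boehmRoot M = .spine (.cst (.omegaDiv _)) := dif_neg hM
    have h' : boehmPrefix (n + 1) [] .base M =
      Hnf.map (boehmPrefix n) (.spine (.cst (.omegaDiv _))) := congrArg (Hnf.map _) h
    exact congrArg (fun t => A.eval (Prefix.toTm (n + 1) [] .base t)) h'

theorem eval_node {M N₁ N₂ : Tm S₀ S₂ [] .base} {a : S₂}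
    (h : Reduces M (.app (.app (.cst (.node a)) N₁) N₂)) :
    A.eval M = A.nodeFun a (A.eval N₁) (A.eval N₂) := A.eval_reduces h

/-- The value of a term is a lower bound of the values of the truncations of its Böhm tree. -/
theorem eval_le_approx (n : ℕ) (M : Tm S₀ S₂ [] .base) : A.eval M ≤ A.approx n M := by
  induction n generalizing M with
  | zero => exact le_top
  | succ n ih =>
    rcases A.eval_eq_approx_or_node M with h | ⟨a, N₁, N₂, h⟩
    · exact (h n).ge
    · rw [A.eval_node h, A.approx_succ_node n h]
      exact A.nodeFun_mono a (ih N₁) (ih N₂)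

theorem approx_antitone (M : Tm S₀ S₂ [] .base) : Antitone fun n => A.approx n M := by
  refine antitone_nat_of_succ_le fun n => ?_
  induction n generalizing M with
  | zero => exact le_top
  | succ n ih =>
    rcases A.eval_eq_approx_or_node M with h | ⟨a, N₁, N₂, h⟩
    · exact ((h _).trans (h _).symm).le
    · rw [A.approx_succ_node _ h, A.approx_succ_node _ h]
      exact A.nodeFun_mono a (ih N₁) (ih N₂)

theorem exists_approx_eq_bbot {M : Tm S₀ S₂ [] .base} (h : bar (A.eval M) ≤ ⊥) :
    ∃ n, A.approx n M = bbot A.QΩ .base := by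
  rw [← eq_bbot_of_bar_le h]
  rcases A.eval_eq_approx_or_node M with h' | ⟨a, N₁, N₂, h'⟩
  · exact ⟨1, h' 0⟩
  · exfalso
    rw [A.eval_node h'] at h
    exact absurd (congrArg (fun p : KK A.QΩ .base => p.1.1) (eq_bbot_of_bar_le h)) Bool.noConfusion

/-! ### The logical relation between `𝒦` and closed terms -/

/-- The logical relation between elements of `𝒦` and closed terms which at the type `0` says that
an element is above the value of some truncation of the Böhm tree. At function types the relation
also asks that the projection to `𝒟` is above that of the value of the term. Not every element of
`𝒟` being the value of a term, this does not follow from the condition on the arguments. -/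
def Dominates : (α : Ty) → KK A.QΩ α → Tm S₀ S₂ [] α → Prop
  | .base, p, M => ∃ n, A.approx n M ≤ p
  | .arr α β, f, M => bar (A.eval M) ≤ bar f ∧
      ∀ g N, Dominates α g N → Dominates β (f.fn g) (.app M N)

variable {A}

theorem Dominates.of_reduces {α : Ty} {p : KK A.QΩ α} {M N : Tm S₀ S₂ [] α} (h : Reduces M N)
    (hN : A.Dominates α p N) : A.Dominates α p M := by
  induction α with
  | base =>
    obtain ⟨n, hn⟩ := hN
    exact ⟨n, (A.approx_eq_of_reduces n h).le.trans hn⟩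
  | arr α β _ ih =>
    refine ⟨?_, fun g P hP => ih (h.app .refl) (hN.2 g P hP)⟩
    rw [A.eval_reduces h]
    exact hN.1

theorem Dominates.bar_le {α : Ty} {p : KK A.QΩ α} {M : Tm S₀ S₂ [] α}
    (h : A.Dominates α p M) : bar (A.eval M) ≤ bar p := by
  cases α with
  | base =>
    obtain ⟨n, hn⟩ := h
    exact bar_mono ((A.eval_le_approx n M).trans hn)
  | arr α β => exact h.1

/-- A term with value projecting below `d` is dominated by `d↑`. At the type `0` the only case with
content is `d = ⊥`, where some truncation of the Böhm tree has the value `(⊥, Q_Ω)`. Applied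
to `d = fix(f̄)` this starts the induction along the iterates which define `Fix(f)`. -/
theorem Dominates.up {α : Ty} {d : DD A.QΩ α} {M : Tm S₀ S₂ [] α} (h : bar (A.eval M) ≤ d) :
    A.Dominates α (up d) M := by
  induction α with
  | base =>
    by_cases hd : d = ⊥
    · subst hd
      obtain ⟨n, hn⟩ := A.exists_approx_eq_bbot h
      exact ⟨n, by rw [hn, bbot_eq_up]⟩
    · have hd' : d = ⊤ := by
        change (d : Bool) = true
        revert hd
        cases (d : Bool) with
        | false => exact fun h => (h rfl).elim
        | true => exact fun _ => rfl
      -- The truncation at depth `0` is `ω`, with the value `⊤`.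
      exact ⟨0, hd' ▸ le_rfl⟩
  | arr α β _ ih =>
    refine ⟨by rwa [bar_up], fun g N hg => ?_⟩
    rw [fn_up]
    refine ih ?_
    rw [eval_app, bar_fn]
    exact ((DD.fn (bar (A.eval M))).monotone hg.bar_le).trans (h _)

theorem Dominates.fixVal {α : Ty} {f : KK A.QΩ (α ⇒ α)} {M : Tm S₀ S₂ [] (α ⇒ α)}
    (h : A.Dominates (α ⇒ α) f M) : A.Dominates α (fixVal f) (.app (.fixY α) M) := by
  obtain ⟨n, hn⟩ := exists_fixVal_eq f
  rw [hn]
  clear hn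
  induction n with
  | zero =>
    refine Dominates.up ?_
    rw [show A.eval (.app (.fixY α) M) = LambdaY.fixVal (A.eval M) from rfl, bar_eq (LL_fixVal _)]
    exact OrderHom.lfp.monotone h.bar_le
  | succ n ih =>
    rw [fixSeq_succ]
    exact (h.2 _ _ ih).of_reduces (.single (.delta M))

variable (A)

theorem dominates_node (a : S₂) : A.Dominates _ (A.nodeVal a) (.cst (.node a)) := by
  refine ⟨le_rfl, fun p₁ N₁ h₁ => ⟨?_, fun p₂ N₂ h₂ => ?_⟩⟩
  · rw [eval_app, bar_fn, bar_fn]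
    exact (DD.fn (bar (A.nodeVal a))).monotone h₁.bar_le
  · obtain ⟨n₁, h₁⟩ := h₁
    obtain ⟨n₂, h₂⟩ := h₂
    -- The subtrees are cut at a common depth; their values decrease with the depth.
    refine ⟨max n₁ n₂ + 1, ?_⟩
    rw [A.approx_succ_node _ .refl]
    exact A.nodeFun_mono a ((A.approx_antitone N₁ (le_max_left _ _)).trans h₁)
      ((A.approx_antitone N₂ (le_max_right _ _)).trans h₂)

theorem dominates_cst {α : Ty} (c : Cst S₀ S₂ α) : A.Dominates α (A.val α c) (.cst c) := by
  cases c with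
  | leaf c => exact ⟨1, (A.approx_succ_spine 0 (s := .cst (.leaf c)) .refl).le⟩
  | node a => exact A.dominates_node a
  | omegaCut α => exact Dominates.up le_top
  | omegaDiv α =>
    have h : A.val α (.omegaDiv α) = LambdaY.up ⊥ := bbot_eq_up α
    rw [h]
    refine Dominates.up (le_of_eq ?_)
    rw [show A.eval (.cst (.omegaDiv α)) = LambdaY.up ⊥ from h, bar_up]

/-- The fundamental lemma of the relation `Dominates`. -/
theorem dominates_evalEnv {Γ : Ctx} {α : Ty} (M : Tm S₀ S₂ Γ α) {ρ : Env A.QΩ Γ}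
    {s : Subst S₀ S₂ Γ []} (h : ∀ β x, A.Dominates β (ρ β x) (s β x)) :
    A.Dominates α (A.evalEnv M ρ) (M.subst s) := by
  induction M with
  | var x => exact h _ x
  | cst c => exact A.dominates_cst c
  | fixY α =>
    refine ⟨le_rfl, fun f N hf => hf.fixVal⟩
  | app M N ihM ihN => exact (ihM h).2 _ _ (ihN h)
  | lam M ih =>
    constructor
    · rw [eval, evalEnv_subst]
      exact A.bar_evalEnv_mono _ fun β x => (h β x).bar_le
    · intro p N hN
      rw [evalEnv_lam]
      refine Dominates.of_reduces (.single (.beta _ _)) ?_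
      rw [Tm.subst_lift_single]
      refine ih fun γ x => ?_
      cases x with
      | zero => exact hN
      | succ x => exact h _ x

/-- With `eval_le_approx`, the truncations of the Böhm tree attain the value of the term. -/
theorem exists_approx_le_eval (M : Tm S₀ S₂ [] .base) : ∃ n, A.approx n M ≤ A.eval M := by
  have h : A.Dominates .base (A.eval M) (M.subst fun _ x => .var x) :=
    A.dominates_evalEnv M fun _ x => nomatch x
  rwa [Tm.subst_var] at h

end TAC

end Approx

end LambdaY

theorem mainTheorem3 {Q : Type*} [Finite Q] {S₀ S₂ : Type*} (A : LambdaY.TAC Q S₀ S₂)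
    (M : LambdaY.Tm S₀ S₂ [] LambdaY.Ty.base) :
    IsGLB (Set.range fun n : ℕ => A.eval ((LambdaY.boehmTree M).truncate n)) (A.eval M) := by
  refine ⟨?_, fun p hp => ?_⟩
  · rintro _ ⟨n, rfl⟩
    exact A.eval_le_approx n M
  · obtain ⟨n, hn⟩ := A.exists_approx_le_eval M
    exact (hp ⟨n, rfl⟩).trans hn
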